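/- Let $S$ be a connected closed oriented surface and let $D$ be a link diagram on $S$, i.e. a $4$-valent graph embedded in $S$ (components without vertices are allowed) with over/under information at its vertices (crossings). Assume that $D$ admits a source-sink structure: an orientation of the edges such that at each crossing two opposite edges are incoming and the two other, opposite, edges are outgoing. A state $s$ assigns $0$ or $1$ to each crossing; let $D_s$ be the corresponding resolution of $D$, a finite family of disjoint simple closed curves (circles) in $S$. Let $V$ be the $\mathbb Z_2$-vector space with basis $v_+,v_-$, $\deg v_\pm=\pm1$, and let $m\colon V\otimes V\to V$ and $\Delta\colon V\to V\otimes V$ be given by $m(v_+\otimes v_+)=v_+$, $m(v_+\otimes v_-)=m(v_-\otimes v_+)=v_-$, $m(v_-\otimes v_-)=0$, $\Delta(v_+)=v_+\otimes v_-+v_-\otimes v_+$, $\Delta(v_-)=v_-\otimes v_-$. Put $[[D]]=\bigoplus_s V(s)$, where $V(s)$ is the tensor power of $V$ with one factor for each circle of $D_s$, and let $d=\sum_{e}\partial_e\colon[[D]]\to[[D]]$, where $e=(s\to s')$ runs over the changes of the resolution of one crossing from $0$ to $1$, and $\partial_e\colon V(s)\to V(s')$ is $m\otimes\mathrm{id}$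 if two circles of $D_s$ merge into one circle of $D_{s'}$, and $\Delta\otimes\mathrm{id}$ if one circle of $D_s$ splits into two circles of $D_{s'}$. Let $\mathfrak L=[S^1;S]$ be the set of free homotopy classes of oriented loops in $S$, and let $\mathfrak H$ be the quotient of the free abelian group on $\mathfrak L$ by the relations $\bigcirc=0$, for the class $\bigcirc$ of contractible loops, and $[\gamma]=[-\gamma]$ for all loops $\gamma$, where $-\gamma$ is $\gamma$ with the opposite direction. The homotopical grading of a basis tensor $x=\bigotimes_i x_i\in V(s)$, where $x_i\in\{v_+,v_-\}$ corresponds to the circle $C_i$ of $D_s$, is $h(x)=\sum_i\deg(x_i)[C_i]\in\mathfrak H$. Let $d_h\colon[[D]]\to[[D]]$ be the part of $d$ which preserves the homotopical grading: the linear map which sends each basis tensor $x$ to the projection of $d(x)$ onto the span of the basis tensors $y$ with $h(y)=h(x)$. Then $d_h^2=0$. -/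

import Mathlib

open scoped Manifold ContDiff TensorProduct DirectSum

noncomputable section

namespace HomotopicalKhovanov

/-! ### Free homotopy classes and the grading group -/

section Loops

variable (S : Type*) [TopologicalSpace S]

/-- Free loops `S¹ → S`, with `S¹ = ℝ / ℤ`. -/
abbrev FreeLoop := C(UnitAddCircle, S)

/-- The set `[S¹; S]` of homotopy classes of free oriented loops in `S`. -/
def LoopClass : Type _ :=
  Quot (ContinuousMap.Homotopic : FreeLoop S → FreeLoop S → Prop)

variable {S}

/-- The free homotopy class of a loop. -/
def FreeLoop.cls (γ : FreeLoop S) : LoopClass S := Quot.mk _ γ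

/-- The loop traversed in the opposite direction. -/
def FreeLoop.reverse (γ : FreeLoop S) : FreeLoop S := γ.comp ⟨fun z => -z, continuous_neg⟩

/-- The free loop `ℝ / ℤ → S` given by a closed path. -/
def closedPathLoop {p : S} (γ : Path p p) : FreeLoop S where
  toFun := AddCircle.liftIco (1 : ℝ) 0 γ.extend
  continuous_toFun := AddCircle.liftIco_zero_continuous (by simp) γ.continuous_extend.continuousOn

variable (S)

/-- The relations `○ = 0` and `[γ] = [-γ]` in the free abelian group on `[S¹; S]`. -/
def gradingRelations : AddSubgroup (FreeAbelianGroup (LoopClass S)) :=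
  AddSubgroup.closure
    ({g | ∃ γ : FreeLoop S, γ.Nullhomotopic ∧ g = FreeAbelianGroup.of γ.cls} ∪
      {g | ∃ γ : FreeLoop S,
        g = FreeAbelianGroup.of γ.cls - FreeAbelianGroup.of γ.reverse.cls})

/-- The group in which the homotopical grading takes its values. -/
abbrev GradingGroup := FreeAbelianGroup (LoopClass S) ⧸ gradingRelations S

variable {S}

/-- The element `[γ]` of the grading group. -/
def FreeLoop.grade (γ : FreeLoop S) : GradingGroup S :=
  QuotientAddGroup.mk (FreeAbelianGroup.of γ.cls)

end Loops

/-! ### Oriented surfaces -/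

section Orientation

variable (S : Type*) [TopologicalSpace S] [ChartedSpace (EuclideanSpace ℝ (Fin 2)) S]

/-- The transition map from the chart `c` to the chart `c'` has positive Jacobian determinant
wherever it is defined. -/
def PositiveTransition {S : Type*} [TopologicalSpace S]
    (c c' : OpenPartialHomeomorph S (EuclideanSpace ℝ (Fin 2))) : Prop :=
  ∀ y ∈ (c.symm.trans c').source, 0 < (fderiv ℝ (c' ∘ c.symm) y).det

/-- An orientation of a smooth surface, given by an oriented atlas: a family of smooth charts
which cover the surface and whose transition maps have positive Jacobian determinants. -/
structure SurfaceOrientation where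
  charts : Set (OpenPartialHomeomorph S (EuclideanSpace ℝ (Fin 2)))
  smooth : charts ⊆ IsManifold.maximalAtlas (𝓡 2) ∞ S
  cover : ∀ p : S, ∃ c ∈ charts, p ∈ c.source
  positive : ∀ c ∈ charts, ∀ c' ∈ charts, PositiveTransition c c'

variable {S}

/-- A positively oriented smooth chart of an oriented smooth surface. -/
def SurfaceOrientation.IsPositiveChart (o : SurfaceOrientation S)
    (c : OpenPartialHomeomorph S (EuclideanSpace ℝ (Fin 2))) : Prop :=
  c ∈ IsManifold.maximalAtlas (𝓡 2) ∞ S ∧ ∀ c' ∈ o.charts, PositiveTransition c c'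

end Orientation

/-! ### Link diagrams -/

/-- The four points `1, i, -1, -i` of the unit circle, in counterclockwise order. -/
def slotPoint : Fin 4 → EuclideanSpace ℝ (Fin 2) :=
  ![!₂[1, 0], !₂[0, 1], !₂[-1, 0], !₂[0, -1]]

theorem slotPoint_mem (i : Fin 4) :
    slotPoint i ∈ Metric.closedBall (0 : EuclideanSpace ℝ (Fin 2)) 1 := by
  rw [mem_closedBall_zero_iff, EuclideanSpace.norm_eq]
  fin_cases i <;> simp [slotPoint]

/-- A diagram, on the oriented surface `S`, of a link in `S × [0,1]`: a `4`-valent graph embedded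
in `S` (components without vertices are allowed) with over/under information at the vertices.

Around each crossing `x` a positively oriented chart `chart x` onto a neighbourhood of the closed
unit disc is fixed in which the diagram is the union of the horizontal and the vertical diameter,
the horizontal one being the overcrossing strand. The diagram leaves this disc at the four points
`slotPoint i`; the pair `(x, i)` stands for the end at `x` of the edge which leaves there. -/
structure LinkDiagram {S : Type*} [TopologicalSpace S]
    [ChartedSpace (EuclideanSpace ℝ (Fin 2)) S] (o : SurfaceOrientation S) where
  /-- the number of crossings -/
  numCrossings : ℕ
  /-- the number of components without crossings -/
  numFree : ℕ
  chart : Fin numCrossings → OpenPartialHomeomorph S (EuclideanSpace ℝ (Fin 2))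
  chart_positive : ∀ x, o.IsPositiveChart (chart x)
  ball_subset : ∀ x, Metric.closedBall 0 1 ⊆ (chart x).target
  disc_disjoint : ∀ x y, x ≠ y →
    Disjoint ((chart x).symm '' Metric.closedBall 0 1) ((chart y).symm '' Metric.closedBall 0 1)
  /-- the other end of the edge with the given end -/
  opp : Fin numCrossings × Fin 4 → Fin numCrossings × Fin 4
  opp_opp : ∀ e, opp (opp e) = e
  opp_ne : ∀ e, opp e ≠ e
  /-- the part of an edge outside the crossing discs, starting from the given end -/
  arc : ∀ e : Fin numCrossings × Fin 4,
    Path ((chart e.1).symm (slotPoint e.2)) ((chart (opp e).1).symm (slotPoint (opp e).2))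
  arc_opp : ∀ e t, arc (opp e) t = arc e (unitInterval.symm t)
  arc_injective : ∀ e, Function.Injective (arc e)
  arc_disjoint : ∀ e e' t t', arc e t = arc e' t' → e' = e ∨ e' = opp e
  arc_outside : ∀ e x t, t ≠ 0 → t ≠ 1 → arc e t ∉ (chart x).symm '' Metric.closedBall 0 1
  /-- the components without crossings -/
  free : Fin numFree → FreeLoop S
  free_injective : ∀ k, Function.Injective (free k)
  free_disjoint : ∀ k l z w, free k z = free l w → k = l
  free_arc : ∀ k z e t, free k z ≠ arc e t
  free_outside : ∀ k z x, free k z ∉ (chart x).symm '' Metric.closedBall 0 1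

namespace LinkDiagram

variable {S : Type*} [TopologicalSpace S] [ChartedSpace (EuclideanSpace ℝ (Fin 2)) S]
  {o : SurfaceOrientation S} (D : LinkDiagram o)

/-- The ends of edges at crossings (half-edges of the `4`-valent graph). -/
abbrev End := Fin D.numCrossings × Fin 4

/-- A source-sink structure: an orientation of the edges such that at each crossing there are two
opposite incoming and two opposite outgoing edges. Here `out e` says that the edge with the end `e`
is directed away from the crossing at this end. -/
structure SourceSink where
  out : D.End → Bool
  out_opp : ∀ e, out (D.opp e) = !out e
  out_opposite : ∀ x i, out (x, i + 2) = out (x, i)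
  out_adjacent : ∀ x i, out (x, i + 1) = !out (x, i)

/-! ### States and circles -/

/-- A state: `false` is the resolution `0`, `true` is the resolution `1`. -/
abbrev State := Fin D.numCrossings → Bool

/-- How a resolution joins the four ends at a crossing. The resolution `0` joins the two regions
swept by the overcrossing (horizontal) strand when it turns counterclockwise. -/
def joined : Bool → Fin 4 → Fin 4
  | false => ![3, 2, 1, 0]
  | true => ![1, 0, 3, 2]

variable {D}

/-- The end to which the given end is joined inside the crossing disc in the state `s`. -/
def State.join (s : D.State) (e : D.End) : D.End := (e.1, joined (s e.1) e.2)

/-- The next edge on a circle of the resolved diagram: run along the edge from the end `e` to its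
other end, then along the arc inside the crossing disc. -/
def State.next (s : D.State) (e : D.End) : D.End := s.join (D.opp e)

/-- The circles of the resolved diagram `D_s`: classes of ends lying on a common circle, and the
components of `D` without crossings. -/
abbrev State.Circ (s : D.State) : Type :=
  Quot (fun e e' : D.End => e' = D.opp e ∨ e' = s.join e) ⊕ Fin D.numFree

/-- The circle of `D_s` on which the end `e` lies. -/
def State.circ (s : D.State) (e : D.End) : s.Circ := Sum.inl (Quot.mk _ e)

instance (s : D.State) : Fintype s.Circ := Fintype.ofFinite _

instance (s : D.State) : DecidableEq s.Circ := Classical.decEq _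

variable (D)

/-- The point at which the end `e` leaves its crossing disc. -/
def pt (e : D.End) : S := (D.chart e.1).symm (slotPoint e.2)

/-- The segment between two of the four points at a crossing, inside the crossing disc. -/
def chord (x : Fin D.numCrossings) (i j : Fin 4) : Path (D.pt (x, i)) (D.pt (x, j)) where
  toFun t := (D.chart x).symm (AffineMap.lineMap (slotPoint i) (slotPoint j) (t : ℝ))
  continuous_toFun := by
    refine (D.chart x).continuousOn_symm.comp_continuous
      (AffineMap.lineMap_continuous.comp continuous_subtype_val) fun t => D.ball_subset x ?_
    exact (convex_closedBall _ _).lineMap_mem (slotPoint_mem i) (slotPoint_mem j) t.2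
  source' := by simp [pt]
  target' := by simp [pt]

variable {D}

/-- The piece of a circle of `D_s` from the end `e` to the end `s.next e`. -/
def State.step (s : D.State) (e : D.End) : Path (D.pt e) (D.pt (s.next e)) :=
  Path.trans (D.arc e : Path (D.pt e) (D.pt (D.opp e)))
    (D.chord (D.opp e).1 (D.opp e).2 (joined (s (D.opp e).1) (D.opp e).2))

/-- The concatenation of `n` successive pieces of a circle of `D_s`, starting from `e`. -/
def State.walk (s : D.State) : ∀ (n : ℕ) (e : D.End), Path (D.pt e) (D.pt (s.next^[n] e))
  | 0, e => Path.refl (D.pt e)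
  | n + 1, e => (s.step e).trans (s.walk n (s.next e))

/-- The circle of `D_s` through the end `e`, traversed once from `e`. -/
def State.loop (s : D.State) (e : D.End) : Path (D.pt e) (D.pt e) :=
  (s.walk (Function.minimalPeriod s.next e) e).cast rfl
    (by rw [Function.iterate_minimalPeriod])

/-- A parametrization of a circle of `D_s`; the starting point and the direction are arbitrary and
do not affect the element of the grading group. -/
def State.param (s : D.State) : s.Circ → FreeLoop S
  | Sum.inl q => closedPathLoop (s.loop q.out)
  | Sum.inr k => D.free k

end LinkDiagram

/-! ### The Khovanov complex over `ℤ/2` -/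

/-- The space `V` with the basis `v₊, v₋`. -/
abbrev V := Bool → ZMod 2

/-- The basis of `V`: `v₊` has the index `true` and `v₋` the index `false`. -/
def vBasis : Module.Basis Bool (ZMod 2) V := Pi.basisFun (ZMod 2) Bool

/-- `deg v₊ = 1` and `deg v₋ = -1`. -/
def vdeg (ε : Bool) : ℤ := if ε then 1 else -1

/-- The multiplication `m : V ⊗ V → V`. -/
def mMap : V ⊗[ZMod 2] V →ₗ[ZMod 2] V :=
  (vBasis.tensorProduct vBasis).constr (ZMod 2) fun
    | (true, true) => vBasis true
    | (true, false) => vBasis false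
    | (false, true) => vBasis false
    | (false, false) => 0

/-- The comultiplication `Δ : V → V ⊗ V`. -/
def deltaMap : V →ₗ[ZMod 2] V ⊗[ZMod 2] V :=
  vBasis.constr (ZMod 2) fun
    | true => vBasis true ⊗ₜ vBasis false + vBasis false ⊗ₜ vBasis true
    | false => vBasis false ⊗ₜ vBasis false

namespace LinkDiagram

variable {S : Type*} [TopologicalSpace S] [ChartedSpace (EuclideanSpace ℝ (Fin 2)) S]
  {o : SurfaceOrientation S} {D : LinkDiagram o}

/-- The tensor power `V(s)` of `V`, with one factor for each circle of `D_s`. -/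
abbrev State.space (s : D.State) : Type := ⨂[ZMod 2] _ : s.Circ, V

/-- The basis of `V(s)` of the tensors whose factors are `v₊` and `v₋`. -/
def State.basis (s : D.State) : Module.Basis (s.Circ → Bool) (ZMod 2) s.space :=
  Basis.piTensorProduct fun _ => vBasis

/-- The state obtained from `s` by switching the resolution at `x` to `1`. -/
def State.switch (s : D.State) (x : Fin D.numCrossings) : D.State := Function.update s x true

/-- A circle of `D_s` passes near the crossing `x`. In every resolution the ends `0` and `2` at a
crossing lie on the two different arcs of the resolved crossing. -/
def State.Touches (s : D.State) (x : Fin D.numCrossings) (c : s.Circ) : Prop :=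
  c = s.circ (x, 0) ∨ c = s.circ (x, 2)

/-- The labels of the circles which do not pass near `x`, and hence are common to `D_s` and
`D_{s'}` for `s' = s.switch x`, are the same. -/
def State.SameAway (s : D.State) (x : Fin D.numCrossings) (a : s.Circ → Bool)
    (b : (s.switch x).Circ → Bool) : Prop :=
  (∀ e : D.End, ¬ s.Touches x (s.circ e) → a (s.circ e) = b ((s.switch x).circ e)) ∧
    ∀ k : Fin D.numFree, a (Sum.inr k) = b (Sum.inr k)

open Classical in
/-- The matrix of the partial differential in the bases of tensors of `v₊` and `v₋`: it is
`m ⊗ id` if the two circles of `D_s` near `x` merge into one, and `Δ ⊗ id` if the circle of `D_s`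
near `x` splits into two. (If neither happens, which is impossible for diagrams with a source-sink
structure, the map is zero.) -/
def State.partialCoeff (s : D.State) (x : Fin D.numCrossings) (a : s.Circ → Bool)
    (b : (s.switch x).Circ → Bool) : ZMod 2 :=
  let c₁ := s.circ (x, 0)
  let c₂ := s.circ (x, 2)
  let c₁' := (s.switch x).circ (x, 0)
  let c₂' := (s.switch x).circ (x, 2)
  if s.SameAway x a b then
    if c₁ ≠ c₂ ∧ c₁' = c₂' then
      vBasis.repr (mMap (vBasis (a c₁) ⊗ₜ vBasis (a c₂))) (b c₁')
    else if c₁ = c₂ ∧ c₁' ≠ c₂' then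
      (vBasis.tensorProduct vBasis).repr (deltaMap (vBasis (a c₁))) (b c₁', b c₂')
    else 0
  else 0

/-- The partial differential `V(s) → V(s')` for the edge `s → s'` of the state cube which changes
the resolution at `x`. -/
def State.partialMap (s : D.State) (x : Fin D.numCrossings) :
    s.space →ₗ[ZMod 2] (s.switch x).space :=
  s.basis.constr (ZMod 2) fun a => ∑ b, s.partialCoeff x a b • (s.switch x).basis b

variable (D)

/-- The chain space `[[D]]`: the direct sum of the spaces `V(s)` over all states. -/
abbrev Chains : Type := ⨁ s : D.State, s.space

/-- The basis of `[[D]]` of the tensors whose factors are `v₊` and `v₋`. -/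
def chainBasis : Module.Basis (Σ s : D.State, s.Circ → Bool) (ZMod 2) D.Chains :=
  DFinsupp.basis fun s : D.State => s.basis

/-- The Khovanov differential: the sum of the partial differentials over all edges of the state
cube. -/
def d : D.Chains →ₗ[ZMod 2] D.Chains :=
  ∑ e : {e : D.State × Fin D.numCrossings // e.1 e.2 = false},
    DirectSum.lof (ZMod 2) D.State State.space (e.1.1.switch e.1.2) ∘ₗ
      e.1.1.partialMap e.1.2 ∘ₗ DirectSum.component (ZMod 2) D.State State.space e.1.1

/-- The homotopical grading `∑ deg(x_i) [C_i]` of a basis tensor. -/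
def hgrade (x : Σ s : D.State, s.Circ → Bool) : GradingGroup S :=
  ∑ c : x.1.Circ, vdeg (x.2 c) • (x.1.param c).grade

open Classical in
/-- The projection of `[[D]]` onto its homogeneous component of homotopical grading `g`. -/
def hproj (g : GradingGroup S) : D.Chains →ₗ[ZMod 2] D.Chains :=
  D.chainBasis.constr (ZMod 2) fun x => if D.hgrade x = g then D.chainBasis x else 0

/-- The part `d_h` of the Khovanov differential which preserves the homotopical grading: on a basis
tensor `x` it is `d x` followed by the projection to the component of the grading of `x`. -/
def dh : D.Chains →ₗ[ZMod 2] D.Chains :=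
  D.chainBasis.constr (ZMod 2) fun x => D.hproj (D.hgrade x) (D.d (D.chainBasis x))

end LinkDiagram

end HomotopicalKhovanov

end

noncomputable section

namespace HomotopicalKhovanov

/-! ### Loops, closed paths and the weight of a class -/

section LoopFacts

variable {S : Type*} [TopologicalSpace S]

/-! The proof compares `d_h` with the integer weight `w ∘ h`, where `w = gradeWeight` sends every
noncontractible class to 1.

Along an edge of the state cube the three circles near the crossing behave like the boundary of a
pair of pants. In the fundamental group their classes are, up to conjugation and inversion, `u`, `v`
and a product `v * u`. If one of the three is trivial, the other two have the same grade. Checking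
the nonzero entries of `m` and `Δ` gives `weight_hgrade_le`: `d` never raises `w ∘ h`, and where it
preserves `w ∘ h` it preserves `h` itself. So if `α → β → γ` has nonzero coefficients and `h γ = h
α`, the weight of `β` is squeezed and `h β = h α`. The entry of `d_h²` from `α` to `γ` is then that
of `d²`; if `h γ ≠ h α` it vanishes trivially (`dh_comp_dh`).

The product formula comes from choosing paths from a base point to all ends so that the chords
inside the crossing discs have trivial holonomy (`exists_letters`). Each edge then has one letter in
the fundamental group, the same for all states, and a circle is the word read along an orbit of
`next`. By the source-sink structure, changing one resolution composes `next`, on outgoing ends,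
with a transposition of two ends (`DifferAt.swapsAfter`). This joins two cycles and multiplies their
words, or cuts one cycle in two; a circle never passes to a single circle.

For `d² = 0`, write `d` as a sum of one operator per crossing. These operators commute with the
multiplications by `v₋` in the circle factors, so it suffices to compare them on the tensors with
all factors `v₊`. There each is the identity (merge) or a sum of two multiplications (split), and
`factor_factor_allPlus` settles each face of the cube by counting circles. In characteristic 2
commuting operators give `d² = 0`. -/

theorem closedPathLoop_coe {p : S} (γ : Path p p) (t : unitInterval) :
    closedPathLoop γ ((t : ℝ) : UnitAddCircle) = γ t := by
  -- `AddCircle.liftIco` is evaluated on `[0, 1)`, so `t = 1` has to be replaced by `0`.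
  rcases eq_or_lt_of_le t.2.2 with h | h
  · have h1 : t = 1 := Subtype.ext h
    subst h1
    have : (((1 : unitInterval) : ℝ) : UnitAddCircle) = ((0 : ℝ) : UnitAddCircle) := by
      simp
    rw [this]
    exact (AddCircle.liftIco_zero_coe_apply (p := (1 : ℝ)) (x := (0 : ℝ))
      ⟨le_rfl, one_pos⟩).trans (show γ.extend (0 : ℝ) = γ 1 by rw [γ.extend_zero, γ.target])
  · exact (AddCircle.liftIco_zero_coe_apply (p := (1 : ℝ)) (x := (t : ℝ)) ⟨t.2.1, h⟩).trans
      (γ.extend_apply t.2)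

theorem exists_unitInterval_coe (z : UnitAddCircle) :
    ∃ t : unitInterval, ((t : ℝ) : UnitAddCircle) = z := by
  obtain ⟨y, hy, rfl⟩ := (AddCircle.coe_image_Icc_eq (1 : ℝ) 0).symm ▸ Set.mem_univ z
  exact ⟨⟨y, hy.1, by simpa using hy.2⟩, rfl⟩

theorem FreeLoop.ext_unitInterval {f g : FreeLoop S}
    (h : ∀ t : unitInterval, f ((t : ℝ) : UnitAddCircle) = g ((t : ℝ) : UnitAddCircle)) :
    f = g := by
  ext z
  obtain ⟨t, rfl⟩ := exists_unitInterval_coe z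
  exact h t

/-- A path homotopy is a map on the square that respects the gluing of its two sides. It descends to
the cylinder because the gluing map is a continuous surjection from a compact space to a Hausdorff
one. -/
theorem closedPathLoop_homotopic {p : S} {γ δ : Path p p} (h : γ.Homotopic δ) :
    (closedPathLoop γ).Homotopic (closedPathLoop δ) := by
  obtain ⟨H⟩ := h
  let q : unitInterval × unitInterval → unitInterval × UnitAddCircle :=
    Prod.map id fun t => ((t : ℝ) : UnitAddCircle)
  have hq : Topology.IsQuotientMap q := by
    refine Topology.IsQuotientMap.of_surjective_continuous ?_ ?_
    · exact Function.surjective_id.prodMap exists_unitInterval_coe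
    · exact continuous_id.prodMap ((AddCircle.continuous_mk' 1).comp continuous_subtype_val)
  refine ⟨⟨⟨fun z => closedPathLoop (H.eval z.1) z.2, ?_⟩, fun z => ?_, fun z => ?_⟩⟩
  · refine hq.continuous_iff.2 ?_
    have : (fun z : unitInterval × UnitAddCircle => closedPathLoop (H.eval z.1) z.2) ∘ q = H := by
      funext z
      exact closedPathLoop_coe _ _
    rw [this]
    exact H.continuous
  · simp
  · simp

/-- A half turn of the circle exchanges the two halves of the concatenation, and rotations are
homotopic to the identity. -/
theorem closedPathLoop_trans_comm {p q : S} (α : Path p q) (β : Path q p) :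
    (closedPathLoop (α.trans β)).Homotopic (closedPathLoop (β.trans α)) := by
  let f := closedPathLoop (α.trans β)
  let F : (f.comp ⟨fun z => z + ((0 : ℝ) : UnitAddCircle), by fun_prop⟩).Homotopy
      (f.comp ⟨fun z => z + ((1 / 2 : ℝ) : UnitAddCircle), by fun_prop⟩) :=
    { toFun := fun z => f (z.2 + (((z.1 : ℝ) / 2 : ℝ) : UnitAddCircle))
      continuous_toFun := by
        have : Continuous fun z : unitInterval × UnitAddCircle =>
            (((z.1 : ℝ) / 2 : ℝ) : UnitAddCircle) :=
          (AddCircle.continuous_mk' 1).comp (by fun_prop)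
        exact f.continuous.comp (continuous_snd.add this)
      map_zero_left := by intro z; simp
      map_one_left := by intro z; simp }
  have h0 : f.comp ⟨fun z => z + ((0 : ℝ) : UnitAddCircle), by fun_prop⟩ = f := by
    ext z; simp
  have h1 : f.comp ⟨fun z => z + ((1 / 2 : ℝ) : UnitAddCircle), by fun_prop⟩ =
      closedPathLoop (β.trans α) := by
    refine FreeLoop.ext_unitInterval fun t => ?_
    rw [closedPathLoop_coe]
    change f (((t : ℝ) : UnitAddCircle) + ((1 / 2 : ℝ) : UnitAddCircle)) = _
    rw [← AddCircle.coe_add]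
    by_cases ht : (t : ℝ) ≤ 1 / 2
    · refine (closedPathLoop_coe (α.trans β) ⟨(t : ℝ) + 1 / 2, by linarith [t.2.1], by linarith⟩).trans ?_
      rw [Path.trans_apply, Path.trans_apply, dif_pos ht]
      -- Here `t + 1/2 ≤ 1/2` forces `t = 0`, where both pieces are at the common endpoint `q`.
      split_ifs with h
      · have h0 : (t : ℝ) = 0 := le_antisymm (by simpa using h) t.2.1
        have e1 : (⟨2 * ((t : ℝ) + 1 / 2), (unitInterval.mul_pos_mem_iff zero_lt_two).2
            ⟨by linarith, h⟩⟩ : unitInterval) = 1 := Subtype.ext (by simp [h0])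
        have e2 : (⟨2 * (t : ℝ), (unitInterval.mul_pos_mem_iff zero_lt_two).2
            ⟨t.2.1, ht⟩⟩ : unitInterval) = 0 := Subtype.ext (by simp [h0])
        rw [e1, e2]; simp
      · congr 1
        exact Subtype.ext (by simp; ring)
    · have e : (((t : ℝ) + 1 / 2 : ℝ) : UnitAddCircle) = (((t : ℝ) - 1 / 2 : ℝ) : UnitAddCircle) := by
        have := AddCircle.coe_add_period (1 : ℝ) ((t : ℝ) - 1 / 2)
        rw [← this]; congr 1; ring
      rw [e]
      refine (closedPathLoop_coe (α.trans β) ⟨(t : ℝ) - 1 / 2, by linarith, by linarith [t.2.2]⟩).trans ?_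
      rw [Path.trans_apply, Path.trans_apply, dif_neg ht, dif_pos (by simp; linarith [t.2.2])]
      congr 1
      exact Subtype.ext (by simp; ring)
  have : f.Homotopic (closedPathLoop (β.trans α)) := by
    rw [← h1]; nth_rw 1 [← h0]; exact ⟨F⟩
  exact this

theorem closedPathLoop_symm {p : S} (γ : Path p p) :
    closedPathLoop γ.symm = (closedPathLoop γ).reverse := by
  refine FreeLoop.ext_unitInterval fun t => ?_
  rw [closedPathLoop_coe]
  change _ = closedPathLoop γ (-((t : ℝ) : UnitAddCircle))
  have e : (-((t : ℝ) : UnitAddCircle)) = ((unitInterval.symm t : ℝ) : UnitAddCircle) := by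
    rw [← AddCircle.coe_neg, ← AddCircle.coe_add_period (1 : ℝ)]
    congr 1
    simp; ring
  rw [e, closedPathLoop_coe]
  rfl

theorem closedPathLoop_refl (p : S) : closedPathLoop (Path.refl p) = ContinuousMap.const _ p := by
  refine FreeLoop.ext_unitInterval fun t => ?_
  rw [closedPathLoop_coe]
  rfl

/-- The path which runs once around the circle `ℝ / ℤ`. -/
def unitCirclePath : Path (0 : UnitAddCircle) 0 where
  toFun t := ((t : ℝ) : UnitAddCircle)
  continuous_toFun := (AddCircle.continuous_mk' 1).comp continuous_subtype_val
  source' := by simp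
  target' := by simp

/-- A free contraction moves the base point along a path `η`. It shows that `γ` followed by `η` is
homotopic to `η` followed by a constant path, and `η` cancels. -/
theorem closedPathLoop_nullhomotopic_iff {p : S} (γ : Path p p) :
    (closedPathLoop γ).Nullhomotopic ↔ γ.Homotopic (Path.refl p) := by
  constructor
  · rintro ⟨y, ⟨F⟩⟩
    have h := Path.Homotopic.map_trans_evalAt F unitCirclePath
    have h0 : closedPathLoop γ 0 = p := by
      simpa using closedPathLoop_coe γ 0
    have hγ : (unitCirclePath.map (map_continuous (closedPathLoop γ))).cast h0.symm h0.symm = γ := by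
      ext t
      exact closedPathLoop_coe γ t
    set δ := unitCirclePath.map (map_continuous (closedPathLoop γ)) with hδ
    have hc : unitCirclePath.map (map_continuous (ContinuousMap.const UnitAddCircle y)) =
        Path.refl y := by
      ext t; rfl
    rw [hc] at h
    set η : Path (closedPathLoop γ 0) y := F.evalAt 0
    have key : Path.Homotopic.Quotient.mk δ = Path.Homotopic.Quotient.refl _ := by
      have h2 : (Path.Homotopic.Quotient.mk δ).trans (.mk η) = .mk η := by
        exact (Path.Homotopic.Quotient.eq.2 h).trans
          (Path.Homotopic.Quotient.trans_refl (.mk η))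
      have h3 := congrArg (fun u => u.trans (Path.Homotopic.Quotient.mk η).symm) h2
      simpa [Path.Homotopic.Quotient.trans_assoc] using h3
    have key2 : δ.Homotopic (Path.refl _) := Path.Homotopic.Quotient.eq.1 key
    have := key2.pathCast h0.symm h0.symm
    rw [hγ] at this
    have hr : Path.refl p = (Path.refl (closedPathLoop γ 0)).cast h0.symm h0.symm := by
      ext t
      exact h0.symm
    rwa [hr]
  · intro h
    refine ⟨p, ?_⟩
    rw [← closedPathLoop_refl]
    exact closedPathLoop_homotopic h

theorem FreeLoop.cls_eq_of_homotopic {f g : FreeLoop S} (h : f.Homotopic g) : f.cls = g.cls :=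
  Quot.sound h

theorem FreeLoop.grade_eq_of_homotopic {f g : FreeLoop S} (h : f.Homotopic g) :
    f.grade = g.grade := by
  rw [FreeLoop.grade, FreeLoop.grade, FreeLoop.cls_eq_of_homotopic h]

theorem FreeLoop.grade_reverse (f : FreeLoop S) : f.reverse.grade = f.grade := by
  refine (QuotientAddGroup.eq_iff_sub_mem.2 ?_).symm
  exact AddSubgroup.subset_closure (Or.inr ⟨f, rfl⟩)

theorem FreeLoop.grade_eq_zero {f : FreeLoop S} (h : f.Nullhomotopic) : f.grade = 0 :=
  (QuotientAddGroup.eq_zero_iff _).2 (AddSubgroup.subset_closure (Or.inl ⟨f, h, rfl⟩))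

theorem FreeLoop.reverse_reverse (f : FreeLoop S) : f.reverse.reverse = f := by
  ext z
  change f (- -z) = f z
  rw [neg_neg]

theorem FreeLoop.nullhomotopic_reverse {f : FreeLoop S} :
    f.reverse.Nullhomotopic ↔ f.Nullhomotopic := by
  have h : ∀ {f : FreeLoop S}, f.Nullhomotopic → f.reverse.Nullhomotopic := fun hf =>
    hf.comp_left _
  refine ⟨fun hf => ?_, h⟩
  have := h hf
  rwa [FreeLoop.reverse_reverse] at this

theorem nullhomotopic_congr {f g : FreeLoop S} (h : f.Homotopic g) :
    f.Nullhomotopic ↔ g.Nullhomotopic :=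
  ⟨fun ⟨y, hy⟩ => ⟨y, h.symm.trans hy⟩, fun ⟨y, hy⟩ => ⟨y, h.trans hy⟩⟩

open Classical in
/-- `0` on the class of contractible loops and `1` on the other classes. -/
def LoopClass.weight : LoopClass S → ℤ :=
  Quot.lift (fun f : FreeLoop S => if f.Nullhomotopic then 0 else 1) fun f g h => by
    simp only [nullhomotopic_congr h]

open Classical in
theorem weight_cls (f : FreeLoop S) : f.cls.weight = if f.Nullhomotopic then 0 else 1 := rfl

open Classical in
theorem weight_reverse (f : FreeLoop S) : f.reverse.cls.weight = f.cls.weight := by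
  rw [weight_cls, weight_cls]
  exact if_congr FreeLoop.nullhomotopic_reverse rfl rfl

/-- The homomorphism from the grading group to `ℤ` which sends each nontrivial class to `1`. -/
def gradeWeight : GradingGroup S →+ ℤ :=
  QuotientAddGroup.lift _ (FreeAbelianGroup.lift LoopClass.weight) <| by
    rw [gradingRelations, AddSubgroup.closure_le]
    rintro g (⟨γ, hγ, rfl⟩ | ⟨γ, rfl⟩)
    · simp [weight_cls, hγ]
    · simp [weight_reverse]

open Classical in
theorem gradeWeight_grade (f : FreeLoop S) :
    gradeWeight f.grade = if f.Nullhomotopic then 0 else 1 := by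
  rw [← weight_cls]
  exact FreeAbelianGroup.lift_apply_of _ _

/-- The relations cannot kill a noncontractible class, because `gradeWeight` respects them and is 1
on it. -/
theorem FreeLoop.grade_eq_zero_iff (f : FreeLoop S) : f.grade = 0 ↔ f.Nullhomotopic := by
  refine ⟨fun h => ?_, FreeLoop.grade_eq_zero⟩
  by_contra hf
  have := gradeWeight_grade f
  simp [h, hf] at this

open Classical in
theorem gradeWeight_grade_eq (f : FreeLoop S) :
    gradeWeight f.grade = if f.grade = 0 then 0 else 1 := by
  rw [gradeWeight_grade]
  simp only [FreeLoop.grade_eq_zero_iff]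

/-- The grade of an element of the fundamental group. -/
def loopGrade {p : S} (u : FundamentalGroup S p) : GradingGroup S :=
  Quotient.lift (s := Path.Homotopic.setoid p p) (fun γ : Path p p => (closedPathLoop γ).grade)
    (fun _ _ h => FreeLoop.grade_eq_of_homotopic (closedPathLoop_homotopic h)) u

theorem loopGrade_mk {p : S} (γ : Path p p) :
    loopGrade (FundamentalGroup.fromPath (.mk γ)) = (closedPathLoop γ).grade := rfl

theorem loopGrade_eq_zero_iff {p : S} (u : FundamentalGroup S p) : loopGrade u = 0 ↔ u = 1 := by
  obtain ⟨γ, rfl⟩ := Path.Homotopic.Quotient.mk_surjective u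
  rw [loopGrade_mk, FreeLoop.grade_eq_zero_iff, closedPathLoop_nullhomotopic_iff,
    ← Path.Homotopic.Quotient.eq]
  rfl

theorem loopGrade_inv {p : S} (u : FundamentalGroup S p) : loopGrade u⁻¹ = loopGrade u := by
  obtain ⟨γ, rfl⟩ := Path.Homotopic.Quotient.mk_surjective u
  have : (closedPathLoop γ.symm).grade = (closedPathLoop γ).grade := by
    rw [closedPathLoop_symm, FreeLoop.grade_reverse]
  exact this

theorem loopGrade_mul_comm {p : S} (u v : FundamentalGroup S p) :
    loopGrade (u * v) = loopGrade (v * u) := by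
  obtain ⟨γ, rfl⟩ := Path.Homotopic.Quotient.mk_surjective u
  obtain ⟨δ, rfl⟩ := Path.Homotopic.Quotient.mk_surjective v
  exact FreeLoop.grade_eq_of_homotopic (closedPathLoop_trans_comm δ γ)

/-- The element of the fundamental group at `p` given by a path from `a` to `b` and paths from `p`
to `a` and `b`. -/
def holonomy {p a b : S} (ta : Path p a) (tb : Path p b) (γ : Path a b) : FundamentalGroup S p :=
  FundamentalGroup.fromPath (.mk (ta.trans (γ.trans tb.symm)))

theorem holonomy_eq {p a b : S} (ta : Path p a) (tb : Path p b) (γ : Path a b) :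
    holonomy ta tb γ =
      ((Path.Homotopic.Quotient.mk ta).trans
        ((Path.Homotopic.Quotient.mk γ).trans (Path.Homotopic.Quotient.mk tb).symm) :
        Path.Homotopic.Quotient p p) := rfl

theorem holonomy_congr {p a b : S} (ta : Path p a) (tb : Path p b) {γ δ : Path a b}
    (h : γ.Homotopic δ) : holonomy ta tb γ = holonomy ta tb δ := by
  rw [holonomy, holonomy, Path.Homotopic.Quotient.eq.2]
  exact .hcomp (.refl _) (.hcomp h (.refl _))

theorem holonomy_refl {p a : S} (ta : Path p a) : holonomy ta ta (Path.refl a) = 1 := by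
  rw [holonomy_eq]
  refine Eq.trans ?_ FundamentalGroup.one_def.symm
  simp

theorem holonomy_trans_self {p a b : S} (ta : Path p a) (γ : Path a b) :
    holonomy ta (ta.trans γ) γ = 1 := by
  rw [holonomy_eq, ← Path.Homotopic.Quotient.trans_assoc, ← Path.Homotopic.Quotient.mk_trans,
    Path.Homotopic.Quotient.trans_symm]
  rfl

/-- The product of `FundamentalGroup` traverses its right factor first, hence the reversed order.
`orbitWord` follows the same convention. -/
theorem holonomy_trans {p a b c : S} (ta : Path p a) (tb : Path p b) (tc : Path p c)
    (γ : Path a b) (δ : Path b c) :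
    holonomy ta tc (γ.trans δ) = holonomy tb tc δ * holonomy ta tb γ := by
  rw [FundamentalGroup.mul_def, holonomy_eq, holonomy_eq, holonomy_eq]
  simp only [Path.Homotopic.Quotient.mk_trans, Path.Homotopic.Quotient.trans_assoc]
  rw [← Path.Homotopic.Quotient.trans_assoc (Path.Homotopic.Quotient.mk tb).symm]
  simp

theorem holonomy_symm {p a b : S} (ta : Path p a) (tb : Path p b) (γ : Path a b) :
    holonomy tb ta γ.symm = (holonomy ta tb γ)⁻¹ := by
  refine eq_inv_of_mul_eq_one_left ?_
  rw [← holonomy_trans, ← holonomy_refl ta, holonomy_congr ta ta]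
  exact Path.Homotopic.Quotient.eq.1 (by simp)

theorem loopGrade_holonomy {p a : S} (ta : Path p a) (γ : Path a a) :
    loopGrade (holonomy ta ta γ) = (closedPathLoop γ).grade := by
  rw [holonomy, loopGrade_mk]
  refine FreeLoop.grade_eq_of_homotopic ((closedPathLoop_trans_comm _ _).trans ?_)
  refine closedPathLoop_homotopic (Path.Homotopic.Quotient.eq.1 ?_)
  simp [Path.Homotopic.Quotient.trans_assoc]

end LoopFacts

/-! ### Words along the orbits of a map -/

section Words

open Function

variable {α G : Type*} [Group G]

/-- The product of the values of `a` at the first `n` points of the orbit of a point under `f`. -/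
def orbitWord (a : α → G) (f : α → α) : ℕ → α → G
  | 0, _ => 1
  | n + 1, e => orbitWord a f n (f e) * a e

theorem orbitWord_add (a : α → G) (f : α → α) (m n : ℕ) (e : α) :
    orbitWord a f (m + n) e = orbitWord a f n (f^[m] e) * orbitWord a f m e := by
  induction m generalizing e with
  | zero => simp [orbitWord]
  | succ m ih =>
    rw [Nat.succ_add_eq_add_succ, Nat.add_succ, orbitWord, ih, orbitWord, mul_assoc]
    rfl

theorem orbitWord_congr (a : α → G) {f g : α → α} {n : ℕ} {e : α}
    (h : ∀ i < n, g^[i] e = f^[i] e) : orbitWord a g n e = orbitWord a f n e := by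
  induction n with
  | zero => rfl
  | succ n ih =>
    rw [orbitWord_add, orbitWord_add, ih fun i hi => h i (hi.trans n.lt_succ_self),
      orbitWord, orbitWord, h n n.lt_succ_self]
    rfl

/-- The word of the full orbit of a periodic point. -/
def cycleWord (a : α → G) (f : α → α) (e : α) : G := orbitWord a f (minimalPeriod f e) e

theorem cycleWord_apply (a : α → G) {f : α → α} {e : α} (he : e ∈ periodicPts f) :
    cycleWord a f (f e) = a e * cycleWord a f e * (a e)⁻¹ := by
  rw [eq_mul_inv_iff_mul_eq, cycleWord, cycleWord, minimalPeriod_apply he]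
  -- One letter more than a full period is read in two ways: with the first letter split off, and
  -- with the last.
  change orbitWord a f (minimalPeriod f e + 1) e = _
  rw [orbitWord_add, iterate_minimalPeriod]
  simp [orbitWord]

/-- Reversal of words: `r` reverses the orbits of `f` and inverts the letters. -/
theorem orbitWord_reverse {a : α → G} {f r : α → α} (hf : ∀ e, f (r (f e)) = r e)
    (ha : ∀ e, a (r (f e)) = (a e)⁻¹) (n : ℕ) (e : α) :
    f^[n] (r (f^[n] e)) = r e ∧ orbitWord a f n (r (f^[n] e)) = (orbitWord a f n e)⁻¹ := by
  induction n generalizing e with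
  | zero => simp [orbitWord]
  | succ n ih =>
    constructor
    · rw [iterate_succ_apply f n e, iterate_succ_apply', (ih (f e)).1, hf]
    · rw [orbitWord_add a f n 1 e, orbitWord, iterate_succ_apply' f n e, hf, ha, (ih e).2]
      simp [orbitWord]

theorem cycleWord_reverse {a : α → G} {f r : α → α} (hf : ∀ e, f (r (f e)) = r e)
    (ha : ∀ e, a (r (f e)) = (a e)⁻¹) (hr : ∀ e, r (r e) = e) (e : α) :
    cycleWord a f (r e) = (cycleWord a f e)⁻¹ := by
  have hdvd : ∀ e, minimalPeriod f (r e) ∣ minimalPeriod f e := fun e => by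
    refine IsPeriodicPt.minimalPeriod_dvd ?_
    have := (orbitWord_reverse hf ha (minimalPeriod f e) e).1
    rwa [iterate_minimalPeriod] at this
  -- Since `r` is an involution, the divisibility holds in both directions.
  have hn : minimalPeriod f (r e) = minimalPeriod f e :=
    Nat.dvd_antisymm (hdvd e) (by simpa [hr] using hdvd (r e))
  have := (orbitWord_reverse hf ha (minimalPeriod f e) e).2
  rw [iterate_minimalPeriod] at this
  rw [cycleWord, hn, this, cycleWord]

/-- On the set `P`, the map `g` is `f` followed by the transposition of `p` and `q`. -/
structure SwapsAfter (f g : α → α) (P : α → Prop) (p q : α) : Prop where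
  map : ∀ e, P e → P (f e)
  left : P p
  right : P q
  ne : p ≠ q
  to_left : ∀ e, P e → f e = p → g e = q
  to_right : ∀ e, P e → f e = q → g e = p
  other : ∀ e, P e → f e ≠ p → f e ≠ q → g e = f e

namespace SwapsAfter

variable {f g : α → α} {P : α → Prop} {p q : α}

theorem symm (h : SwapsAfter f g P p q) : SwapsAfter f g P q p :=
  ⟨h.map, h.right, h.left, h.ne.symm, h.to_right, h.to_left, fun e he h1 h2 => h.other e he h2 h1⟩

theorem iterate_mem (h : SwapsAfter f g P p q) (n : ℕ) : P (f^[n] p) := by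
  induction n with
  | zero => exact h.left
  | succ n ih => rw [iterate_succ_apply']; exact h.map _ ih

theorem iterate_eq (h : SwapsAfter f g P p q) {n : ℕ}
    (hn : ∀ i, 0 < i → i < n → f^[i] p ≠ p ∧ f^[i] p ≠ q) :
    ∀ i < n, g^[i] p = f^[i] p := by
  intro i hi
  induction i with
  | zero => rfl
  | succ i ih =>
    have h1 := hn (i + 1) i.succ_pos hi
    rw [iterate_succ_apply'] at h1
    rw [iterate_succ_apply', iterate_succ_apply', ih (i.lt_succ_self.trans hi)]
    exact h.other _ (h.iterate_mem i) h1.1 h1.2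

/-- The `f`-orbit of `p` meets neither `p` nor `q` before it closes up, so `g` follows `f` until the
last step and then lands on `q` instead of `p`. -/
theorem iterate_of_separate (h : SwapsAfter f g P p q) (hp : p ∈ periodicPts f)
    (hpq : ∀ k, f^[k] p ≠ q) :
    (∀ i < minimalPeriod f p, g^[i] p = f^[i] p) ∧ g^[minimalPeriod f p] p = q := by
  have h1 := h.iterate_eq (n := minimalPeriod f p) fun i hi hin =>
    ⟨not_isPeriodicPt_of_pos_of_lt_minimalPeriod hi.ne' hin, hpq i⟩
  refine ⟨h1, ?_⟩
  obtain ⟨k, hk⟩ := Nat.exists_eq_succ_of_ne_zero (minimalPeriod_pos_of_mem_periodicPts hp).ne'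
  rw [hk, iterate_succ_apply', h1 k (by omega)]
  refine h.to_left _ (h.iterate_mem k) ?_
  have hper := iterate_minimalPeriod (f := f) (x := p)
  rwa [hk, iterate_succ_apply'] at hper

/-- Composing with a transposition joins two cycles: `g` runs through the `f`-cycle of `p`, then
through that of `q`, and is back at `p`. -/
theorem cycleWord_of_separate (a : α → G) (h : SwapsAfter f g P p q) (hp : p ∈ periodicPts f)
    (hq : q ∈ periodicPts f) (hpq : ∀ k, f^[k] p ≠ q) (hqp : ∀ k, f^[k] q ≠ p) :
    cycleWord a g p = cycleWord a f q * cycleWord a f p := by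
  obtain ⟨h1, h2⟩ := h.iterate_of_separate hp hpq
  obtain ⟨h3, h4⟩ := h.symm.iterate_of_separate hq hqp
  set n := minimalPeriod f p
  set m := minimalPeriod f q
  have hn : 0 < n := minimalPeriod_pos_of_mem_periodicPts hp
  have hnm : minimalPeriod g p = n + m := by
    have hper : g^[n + m] p = p := by rw [add_comm, iterate_add_apply, h2, h4]
    -- An earlier return would either shorten the `f`-period of `p` or put `p` on the `f`-orbit of
    -- `q`.
    refine le_antisymm (IsPeriodicPt.minimalPeriod_le (by omega) hper) ?_
    by_contra hlt
    have hpos : 0 < minimalPeriod g p := IsPeriodicPt.minimalPeriod_pos (n := n + m) (by omega) hper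
    have hk := iterate_minimalPeriod (f := g) (x := p)
    set k := minimalPeriod g p
    rcases lt_or_ge k n with hkn | hkn
    · rw [h1 k hkn] at hk
      exact not_isPeriodicPt_of_pos_of_lt_minimalPeriod hpos.ne' hkn hk
    · obtain ⟨j, hj⟩ := Nat.exists_eq_add_of_le hkn
      rw [hj, add_comm, iterate_add_apply, h2, h3 j (by omega)] at hk
      exact hqp j hk
  rw [cycleWord, hnm, orbitWord_add, h2, orbitWord_congr a h1, orbitWord_congr a h3]
  rfl

/-- Composing with a transposition cuts a cycle: if `m` is the first time at which `f` takes `p` to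
`q`, then `g` returns to `p` at time `m`, without having met `q`. -/
theorem separate_of_iterate_eq (h : SwapsAfter f g P p q) (hp : p ∈ periodicPts f)
    {k : ℕ} (hk : f^[k] p = q) (j : ℕ) : g^[j] p ≠ q := by
  classical
  have hex : ∃ k, f^[k] p = q := ⟨k, hk⟩
  obtain ⟨m, hm, hmin⟩ : ∃ m, f^[m] p = q ∧ ∀ i < m, f^[i] p ≠ q :=
    ⟨Nat.find hex, Nat.find_spec hex, fun i hi => Nat.find_min hex hi⟩
  have hm0 : m ≠ 0 := by
    rintro rfl
    exact h.ne hm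
  have hmn : m ≤ minimalPeriod f p := by
    by_contra hlt
    have := hmin (m % minimalPeriod f p)
      ((Nat.mod_lt _ (minimalPeriod_pos_of_mem_periodicPts hp)).trans (by omega))
    rw [iterate_mod_minimalPeriod_eq] at this
    exact this hm
  have h1 := h.iterate_eq (n := m) fun i hi him =>
    ⟨not_isPeriodicPt_of_pos_of_lt_minimalPeriod hi.ne' (by omega), hmin i him⟩
  have hper : IsPeriodicPt g m p := by
    obtain ⟨k, rfl⟩ := Nat.exists_eq_succ_of_ne_zero hm0
    change g^[k + 1] p = p
    rw [iterate_succ_apply', h1 k (by omega)]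
    refine h.to_right _ (h.iterate_mem k) ?_
    rw [← iterate_succ_apply' f]
    exact hm
  rw [← hper.iterate_mod_apply j, h1 _ (Nat.mod_lt _ (by omega))]
  exact hmin _ (Nat.mod_lt _ (by omega))

end SwapsAfter

end Words

namespace LinkDiagram

/-! ### Circles of adjacent states -/

variable {S : Type*} [TopologicalSpace S] [ChartedSpace (EuclideanSpace ℝ (Fin 2)) S]
  {o : SurfaceOrientation S} {D : LinkDiagram o}

theorem joined_joined (b : Bool) (i : Fin 4) : joined b (joined b i) = i := by
  revert b i; decide

/-- Switching a resolution replaces the end reached by the opposite one; this is the source of the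
transposition in `DifferAt.swapsAfter`. -/
theorem joined_not (b : Bool) (i : Fin 4) : joined (!b) i = joined b i + 2 := by
  revert b i; decide

theorem joined_eq (b : Bool) (i : Fin 4) : joined b i = i + 1 ∨ joined b i + 1 = i := by
  revert b i; decide

namespace State

theorem join_join (s : D.State) (e : D.End) : s.join (s.join e) = e :=
  Prod.ext rfl (joined_joined _ _)

theorem next_injective (s : D.State) : Function.Injective s.next :=
  (Function.LeftInverse.injective s.join_join).comp (Function.LeftInverse.injective D.opp_opp)

theorem next_join_next (s : D.State) (e : D.End) : s.next (s.join (s.next e)) = s.join e := by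
  simp only [State.next, join_join, D.opp_opp]

theorem mem_periodicPts_next (s : D.State) (e : D.End) : e ∈ Function.periodicPts s.next :=
  s.next_injective.mem_periodicPts e

theorem circ_opp (s : D.State) (e : D.End) : s.circ (D.opp e) = s.circ e :=
  congrArg Sum.inl (Quot.sound (r := fun e e' : D.End => e' = D.opp e ∨ e' = s.join e)
    (a := e) (b := D.opp e) (Or.inl rfl)).symm

theorem circ_join (s : D.State) (e : D.End) : s.circ (s.join e) = s.circ e :=
  congrArg Sum.inl (Quot.sound (r := fun e e' : D.End => e' = D.opp e ∨ e' = s.join e)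
    (a := e) (b := s.join e) (Or.inr rfl)).symm

theorem circ_next (s : D.State) (e : D.End) : s.circ (s.next e) = s.circ e := by
  rw [State.next, circ_join, circ_opp]

theorem circ_iterate_next (s : D.State) (n : ℕ) (e : D.End) :
    s.circ (s.next^[n] e) = s.circ e := by
  induction n with
  | zero => rfl
  | succ n ih => rw [Function.iterate_succ_apply', circ_next, ih]

/-- A function on ends that is invariant under passing along edges and resolved crossings is
constant on circles. -/
theorem apply_eq_of_circ_eq {s : D.State} {β : Sort*} (f : D.End → β)
    (hopp : ∀ e, f (D.opp e) = f e) (hjoin : ∀ e, f (s.join e) = f e) {e e' : D.End}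
    (h : s.circ e = s.circ e') : f e = f e' := by
  have hf : ∀ a b : D.End, b = D.opp a ∨ b = s.join a → f a = f b := by
    rintro a b (rfl | rfl)
    exacts [(hopp a).symm, (hjoin a).symm]
  have h' := Sum.inl.inj h
  exact congrArg (Quot.lift f hf) h'

theorem circ_crossing (s : D.State) (x : Fin D.numCrossings) :
    (s.circ (x, 1) = s.circ (x, 0) ∧ s.circ (x, 3) = s.circ (x, 2)) ∨
      (s.circ (x, 1) = s.circ (x, 2) ∧ s.circ (x, 3) = s.circ (x, 0)) := by
  have h0 := s.circ_join (x, 0)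
  have h2 := s.circ_join (x, 2)
  cases hs : s x <;> simp [State.join, hs, joined] at h0 h2 <;> simp [h0, h2]

theorem touches_crossing (s : D.State) (x : Fin D.numCrossings) (i : Fin 4) :
    s.Touches x (s.circ (x, i)) := by
  have := s.circ_crossing x
  unfold State.Touches
  fin_cases i <;> simp <;> tauto

/-- The states `s` and `s'` differ exactly at the crossing `x`. -/
structure DifferAt (s s' : D.State) (x : Fin D.numCrossings) : Prop where
  away : ∀ y, y ≠ x → s' y = s y
  not : s' x = !s x

theorem DifferAt.symm {s s' : D.State} {x : Fin D.numCrossings} (h : s.DifferAt s' x) :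
    s'.DifferAt s x :=
  ⟨fun y hy => (h.away y hy).symm, by simp [h.not]⟩

theorem differAt_switch {s : D.State} {x : Fin D.numCrossings} (h : s x = false) :
    s.DifferAt (s.switch x) x :=
  ⟨fun y hy => by simp [State.switch, hy], by simp [State.switch, h]⟩

namespace DifferAt

variable {s s' : D.State} {x : Fin D.numCrossings}

theorem join_eq (h : s.DifferAt s' x) {e : D.End} (he : e.1 ≠ x) : s'.join e = s.join e := by
  simp [State.join, h.away _ he]

theorem touches_of_touches (h : s.DifferAt s' x) {e : D.End} (he : s'.Touches x (s'.circ e)) :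
    s.Touches x (s.circ e) := by
  have key : ∀ {f : D.End}, s'.circ e = s'.circ f →
      s.Touches x (s.circ e) = s.Touches x (s.circ f) := fun hf => by
    refine apply_eq_of_circ_eq (fun g => s.Touches x (s.circ g)) (fun g => by rw [circ_opp])
      (fun g => ?_) hf
    by_cases hg : g.1 = x
    · obtain ⟨y, i⟩ := g
      obtain rfl : y = x := hg
      exact propext (iff_of_true (s.touches_crossing _ _) (s.touches_crossing _ _))
    · rw [h.join_eq hg, circ_join]
  rcases he with he | he
  · rw [key he]; exact s.touches_crossing x 0
  · rw [key he]; exact s.touches_crossing x 2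

theorem touches_iff (h : s.DifferAt s' x) {e : D.End} :
    s'.Touches x (s'.circ e) ↔ s.Touches x (s.circ e) :=
  ⟨h.touches_of_touches, h.symm.touches_of_touches⟩

theorem fst_ne_of_not_touches {e : D.End} (he : ¬ s.Touches x (s.circ e)) : e.1 ≠ x := by
  obtain ⟨y, i⟩ := e
  rintro rfl
  exact he (s.touches_crossing _ _)

theorem circ_eq_of_not_touches (h : s.DifferAt s' x) {e f : D.End}
    (he : ¬ s.Touches x (s.circ e)) (hef : s.circ e = s.circ f) : s'.circ e = s'.circ f := by
  -- The transported property is an implication, so that at ends on circles near `x` its invariance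
  -- is vacuous.
  have : (¬ s.Touches x (s.circ e) → s'.circ e = s'.circ e) =
      (¬ s.Touches x (s.circ f) → s'.circ f = s'.circ e) := by
    refine apply_eq_of_circ_eq (fun g => ¬ s.Touches x (s.circ g) → s'.circ g = s'.circ e)
      (fun g => by rw [circ_opp, circ_opp]) (fun g => ?_) hef
    rw [circ_join]
    refine forall_congr fun hg => ?_
    rw [← h.join_eq (fst_ne_of_not_touches hg), circ_join]
  exact (this.mp (fun _ => rfl) (hef ▸ he)).symm

/-- If the two circles at `x` are merged in `s'`, then `s'` has coarser circles than `s`. -/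
theorem circ_eq_of_circ_eq (h : s.DifferAt s' x) (hx : s'.circ (x, 0) = s'.circ (x, 2))
    {e f : D.End} (hef : s.circ e = s.circ f) : s'.circ e = s'.circ f := by
  by_cases he : s.Touches x (s.circ e)
  · have hf := hef ▸ he
    have h1 := h.touches_iff.2 he
    have h2 := h.touches_iff.2 hf
    unfold State.Touches at h1 h2
    rw [← hx, or_self] at h1 h2
    rw [h1, h2]
  · exact h.circ_eq_of_not_touches he hef

theorem circ_eq_iff_of_merge (h : s.DifferAt s' x) (hx : s'.circ (x, 0) = s'.circ (x, 2))
    {e f : D.End} : s'.circ e = s'.circ f ↔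
      s.circ e = s.circ f ∨ (s.Touches x (s.circ e) ∧ s.Touches x (s.circ f)) := by
  constructor
  · intro hef
    by_cases he : s.Touches x (s.circ e)
    · exact Or.inr ⟨he, h.touches_iff.1 (hef ▸ h.touches_iff.2 he)⟩
    · exact Or.inl (h.symm.circ_eq_of_not_touches (mt h.touches_iff.1 he) hef)
  · rintro (hef | ⟨he, hf⟩)
    · exact h.circ_eq_of_circ_eq hx hef
    · have h1 := h.touches_iff.2 he
      have h2 := h.touches_iff.2 hf
      unfold State.Touches at h1 h2
      rw [← hx, or_self] at h1 h2
      rw [h1, h2]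

theorem iterate_next_eq (h : s.DifferAt s' x) {e : D.End} (he : ¬ s.Touches x (s.circ e))
    (n : ℕ) : s'.next^[n] e = s.next^[n] e := by
  induction n with
  | zero => rfl
  | succ n ih =>
    rw [Function.iterate_succ_apply', Function.iterate_succ_apply', ih, State.next, State.next]
    refine h.join_eq (fst_ne_of_not_touches (s := s) ?_)
    rwa [circ_opp, circ_iterate_next]

theorem cycleWord_eq {G : Type*} [Group G] (a : D.End → G) (h : s.DifferAt s' x) {e : D.End}
    (he : ¬ s.Touches x (s.circ e)) : cycleWord a s'.next e = cycleWord a s.next e := by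
  have : Function.minimalPeriod s'.next e = Function.minimalPeriod s.next e := by
    rw [Function.minimalPeriod_eq_minimalPeriod_iff]
    intro n
    rw [Function.IsPeriodicPt, Function.IsFixedPt, h.iterate_next_eq he]
    rfl
  rw [cycleWord, cycleWord, this, orbitWord_congr a fun i _ => h.iterate_next_eq he i]

end DifferAt

/-- A resolution joins adjacent ends, which have opposite directions. So the edge orientations fit
together to an orientation of every circle of every state. -/
theorem out_join (ss : D.SourceSink) (s : D.State) (e : D.End) :
    ss.out (s.join e) = !ss.out e := by
  obtain ⟨y, i⟩ := e
  rcases joined_eq (s y) i with hi | hi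
  · rw [← ss.out_adjacent y i, ← hi]; rfl
  · conv_rhs => rw [← hi, ss.out_adjacent]
    simp [State.join]

/-- Each circle carries two orbits of `next`, one for each direction, and the outgoing ends pick out
one of them. The invariant used is the orbit of the outgoing end of the edge to which an end
belongs. -/
theorem iterate_next_of_circ_eq (ss : D.SourceSink) {s : D.State} {e f : D.End}
    (he : ss.out e = true) (hf : ss.out f = true) (hef : s.circ e = s.circ f) :
    ∃ k, s.next^[k] e = f := by
  let σ : Equiv.Perm D.End := Equiv.ofBijective s.next
    (Finite.injective_iff_bijective.1 s.next_injective)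
  have key := apply_eq_of_circ_eq (s := s)
    (fun g => (Quotient.mk (Equiv.Perm.SameCycle.setoid σ)
      (if ss.out g then g else D.opp g))) (fun g => ?_) (fun g => ?_) hef
  · simp only [he, hf, if_true] at key
    obtain ⟨i, -, hi⟩ := (Quotient.exact key : Equiv.Perm.SameCycle σ e f).exists_pow_eq'
    refine ⟨i, ?_⟩
    rw [← Equiv.Perm.iterate_eq_pow] at hi
    exact hi
  · rw [ss.out_opp]
    cases ss.out g <;> simp [D.opp_opp]
  · rw [out_join]
    cases hg : ss.out g
    · simp only [Bool.not_false, if_true, Bool.false_eq_true, if_false]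
      refine (Quotient.sound ?_).symm
      refine ⟨1, ?_⟩
      simp [σ, State.next, D.opp_opp]
    · simp only [Bool.not_true, if_true, Bool.false_eq_true, if_false]
      refine Quotient.sound ?_
      refine ⟨1, ?_⟩
      simp [σ, State.next, D.opp_opp, join_join]

theorem exists_out_ends (ss : D.SourceSink) (x : Fin D.numCrossings) :
    ∃ j : Fin 4, (j = 0 ∨ j = 1) ∧ ∀ i, ss.out (x, i) = true ↔ i = j ∨ i = j + 2 := by
  have h0 := ss.out_adjacent x 0
  have h1 := ss.out_adjacent x 1
  have h2 := ss.out_adjacent x 2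
  simp only [zero_add, show (1 : Fin 4) + 1 = 2 from rfl, show (2 : Fin 4) + 1 = 3 from rfl]
    at h0 h1 h2
  cases h : ss.out (x, 0)
  · refine ⟨1, Or.inr rfl, fun i => ?_⟩
    fin_cases i <;> simp [h0, h1, h2, h]
  · refine ⟨0, Or.inl rfl, fun i => ?_⟩
    fin_cases i <;> simp [h0, h1, h2, h]

theorem circ_opposite (s : D.State) (x : Fin D.numCrossings) {j : Fin 4} (hj : j = 0 ∨ j = 1) :
    (s.circ (x, j) = s.circ (x, 0) ∧ s.circ (x, j + 2) = s.circ (x, 2)) ∨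
      (s.circ (x, j) = s.circ (x, 2) ∧ s.circ (x, j + 2) = s.circ (x, 0)) := by
  rcases hj with rfl | rfl
  · exact Or.inl ⟨rfl, rfl⟩
  · exact s.circ_crossing x

theorem out_next (ss : D.SourceSink) (s : D.State) (e : D.End) :
    ss.out (s.next e) = ss.out e := by
  rw [State.next, out_join, ss.out_opp, Bool.not_not]

/-- The only outgoing ends at `x` are the opposite ends `j` and `j + 2`, and these are exchanged by
switching the resolution. -/
theorem DifferAt.swapsAfter (ss : D.SourceSink) {s s' : D.State} {x : Fin D.numCrossings}
    (h : s.DifferAt s' x) {j : Fin 4} (hj : ∀ i, ss.out (x, i) = true ↔ i = j ∨ i = j + 2) :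
    SwapsAfter s.next s'.next (fun e => ss.out e = true) (x, j) (x, j + 2) := by
  have hx : ∀ e, (s.next e).1 = x → s'.next e = (x, (s.next e).2 + 2) := by
    rintro e (he : (D.opp e).1 = x)
    simp only [State.next, State.join, he, h.not, joined_not]
  refine ⟨fun e he => by rw [out_next, he], (hj _).2 (Or.inl rfl), (hj _).2 (Or.inr rfl), ?_,
    fun e he h1 => ?_, fun e he h1 => ?_, fun e he h1 h2 => ?_⟩
  · intro hne
    exact (show ∀ j : Fin 4, j ≠ j + 2 by decide) j (congrArg Prod.snd hne)
  · rw [hx e (by rw [h1]), h1]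
  · rw [hx e (by rw [h1]), h1]
    simp only [add_assoc, show (2 : Fin 4) + 2 = 0 from rfl, add_zero]
  · refine h.join_eq fun he' => ?_
    rw [← out_next ss s] at he
    have e1 : s.next e = (x, (s.next e).2) := Prod.ext he' rfl
    rw [e1, hj] at he
    rcases he with h3 | h3
    · exact h1 (e1.trans (by rw [h3]))
    · exact h2 (e1.trans (by rw [h3]))

theorem merge_of_swapsAfter {G : Type*} [Group G] (a : D.End → G) {P : D.End → Prop}
    {s s' : D.State} {p q : D.End} (h : SwapsAfter s.next s'.next P p q)
    (hpq : s.circ p ≠ s.circ q) : s'.circ p = s'.circ q ∧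
      cycleWord a s'.next p = cycleWord a s.next q * cycleWord a s.next p := by
  have h1 : ∀ k, s.next^[k] p ≠ q := fun k hk => hpq (by rw [← hk, circ_iterate_next])
  have h2 : ∀ k, s.next^[k] q ≠ p := fun k hk => hpq (by rw [← hk, circ_iterate_next])
  refine ⟨?_, h.cycleWord_of_separate a (s.mem_periodicPts_next _) (s.mem_periodicPts_next _) h1 h2⟩
  rw [← (h.iterate_of_separate (s.mem_periodicPts_next _) h1).2, circ_iterate_next]

/-- Two different circles at a crossing are merged when the resolution of the crossing changes, and
the word of the resulting circle is a product of the words of the two circles. -/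
theorem DifferAt.merge {G : Type*} [Group G] (a : D.End → G) (ss : D.SourceSink) {s s' : D.State}
    {x : Fin D.numCrossings} (h : s.DifferAt s' x) (hx : s.circ (x, 0) ≠ s.circ (x, 2)) :
    s'.circ (x, 0) = s'.circ (x, 2) ∧
    ∃ p q : D.End, s.circ p = s.circ (x, 0) ∧ s.circ q = s.circ (x, 2) ∧
      s'.circ p = s'.circ (x, 0) ∧
      cycleWord a s'.next p = cycleWord a s.next q * cycleWord a s.next p := by
  obtain ⟨j, hj01, hj⟩ := exists_out_ends ss x
  have hsw := h.swapsAfter ss hj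
  have hc' := s'.circ_opposite x hj01
  rcases s.circ_opposite x hj01 with ⟨h0, h2⟩ | ⟨h2, h0⟩
  · obtain ⟨h3, h4⟩ := merge_of_swapsAfter a hsw (by rwa [h0, h2])
    have h5 : s'.circ (x, 0) = s'.circ (x, 2) := by
      rcases hc' with ⟨h6, h7⟩ | ⟨h6, h7⟩
      · rw [← h6, ← h7, h3]
      · rw [← h6, ← h7, h3]
    exact ⟨h5, _, _, h0, h2, by rcases hc' with ⟨h6, -⟩ | ⟨h6, -⟩ <;> rw [h6, h5], h4⟩
  -- Here `(x, j)` lies on the circle of `(x, 2)`; the swap is reversed so that `p` is on the circle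
  -- of `(x, 0)`.
  · obtain ⟨h3, h4⟩ := merge_of_swapsAfter a hsw.symm (by rw [h0, h2]; exact hx)
    have h5 : s'.circ (x, 0) = s'.circ (x, 2) := by
      rcases hc' with ⟨h6, h7⟩ | ⟨h6, h7⟩
      · rw [← h6, ← h7, h3]
      · rw [← h6, ← h7, h3]
    exact ⟨h5, _, _, h0, h2, by rcases hc' with ⟨-, h6⟩ | ⟨-, h6⟩ <;> rw [h6, h5], h4⟩

/-- If the two arcs at a crossing lie on one circle, then this circle is split when the resolution
of the crossing changes. -/
theorem DifferAt.split (ss : D.SourceSink) {s s' : D.State} {x : Fin D.numCrossings}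
    (h : s.DifferAt s' x) (hx : s.circ (x, 0) = s.circ (x, 2)) :
    s'.circ (x, 0) ≠ s'.circ (x, 2) := by
  obtain ⟨j, hj01, hj⟩ := exists_out_ends ss x
  have hsw := h.swapsAfter ss hj
  have hpq : s.circ (x, j) = s.circ (x, j + 2) := by
    rcases s.circ_opposite x hj01 with ⟨h0, h2⟩ | ⟨h0, h2⟩ <;> rw [h0, h2, hx]
  obtain ⟨k, hk⟩ := iterate_next_of_circ_eq ss hsw.left hsw.right hpq
  have hne : s'.circ (x, j) ≠ s'.circ (x, j + 2) := fun hc => by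
    obtain ⟨l, hl⟩ := iterate_next_of_circ_eq ss hsw.left hsw.right hc
    exact hsw.separate_of_iterate_eq (s.mem_periodicPts_next _) hk l hl
  rcases s'.circ_opposite x hj01 with ⟨h0, h2⟩ | ⟨h0, h2⟩ <;> rw [h0, h2] at hne
  exacts [hne, hne.symm]

/-- Merging and splitting are the only possibilities. No words are needed here, hence the trivial
group. -/
theorem DifferAt.circ_eq_iff (ss : D.SourceSink) {s s' : D.State} {x : Fin D.numCrossings}
    (h : s.DifferAt s' x) :
    s'.circ (x, 0) = s'.circ (x, 2) ↔ s.circ (x, 0) ≠ s.circ (x, 2) :=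
  ⟨fun hx hx' => h.split ss hx' hx, fun hx => (h.merge (G := Unit) (fun _ => 1) ss hx).1⟩

/-! ### Circles with the components without crossings -/

/-- The circle of a state given by an end or by a component without crossings. -/
def circOf (s : D.State) (e : D.End ⊕ Fin D.numFree) : s.Circ := Sum.map (Quot.mk _) id e

theorem circOf_surjective (s : D.State) : Function.Surjective s.circOf :=
  Function.Surjective.sumMap Quot.mk_surjective Function.surjective_id

theorem circOf_inl (s : D.State) (e : D.End) : s.circOf (Sum.inl e) = s.circ e := rfl

theorem circOf_inr (s : D.State) (k : Fin D.numFree) : s.circOf (Sum.inr k) = Sum.inr k := rfl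

theorem not_touches_inr (s : D.State) (x : Fin D.numCrossings) (k : Fin D.numFree) :
    ¬ s.Touches x (Sum.inr k) := by
  simp [State.Touches, State.circ]

theorem sameAway_iff (s : D.State) (x : Fin D.numCrossings) (a : s.Circ → Bool)
    (b : (s.switch x).Circ → Bool) : s.SameAway x a b ↔
      ∀ e, ¬ s.Touches x (s.circOf e) → a (s.circOf e) = b ((s.switch x).circOf e) := by
  rw [Sum.forall]
  refine and_congr Iff.rfl (forall_congr' fun k => ?_)
  simp [circOf_inr, not_touches_inr]

namespace DifferAt

variable {s s' : D.State} {x : Fin D.numCrossings}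

theorem touches_circOf_iff (h : s.DifferAt s' x) {e : D.End ⊕ Fin D.numFree} :
    s'.Touches x (s'.circOf e) ↔ s.Touches x (s.circOf e) := by
  cases e with
  | inl e => exact h.touches_iff
  | inr k => exact iff_of_false (not_touches_inr _ _ _) (not_touches_inr _ _ _)

theorem circOf_eq_of_not_touches (h : s.DifferAt s' x) {e f : D.End ⊕ Fin D.numFree}
    (he : ¬ s.Touches x (s.circOf e)) (hef : s.circOf e = s.circOf f) :
    s'.circOf e = s'.circOf f := by
  rcases e with e | k <;> rcases f with f | l
  · exact h.circ_eq_of_not_touches he hef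
  · simp [circOf_inr, circOf_inl, State.circ] at hef
  · simp [circOf_inr, circOf_inl, State.circ] at hef
  · simpa [circOf_inr] using hef

/-- A circle away from the crossing at which two states differ, as a circle of the other state. -/
def transport (_ : s.DifferAt s' x) (c : s.Circ) : s'.Circ :=
  s'.circOf (Function.surjInv s.circOf_surjective c)

theorem transport_circOf (h : s.DifferAt s' x) {e : D.End ⊕ Fin D.numFree}
    (he : ¬ s.Touches x (s.circOf e)) : h.transport (s.circOf e) = s'.circOf e :=
  (h.circOf_eq_of_not_touches he
    (Function.surjInv_eq s.circOf_surjective (s.circOf e)).symm).symm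

theorem touches_transport (h : s.DifferAt s' x) {c : s.Circ} :
    s'.Touches x (h.transport c) ↔ s.Touches x c := by
  rw [transport, h.touches_circOf_iff, Function.surjInv_eq s.circOf_surjective]

theorem transport_transport (h : s.DifferAt s' x) {c : s.Circ} (hc : ¬ s.Touches x c) :
    h.symm.transport (h.transport c) = c := by
  obtain ⟨e, rfl⟩ := s.circOf_surjective c
  rw [h.transport_circOf hc, h.symm.transport_circOf (mt h.touches_circOf_iff.1 hc)]

open Classical in
/-- Sums over the circles away from the crossing at which two states differ. -/
theorem sum_not_touches {M : Type*} [AddCommMonoid M] (h : s.DifferAt s' x) (f : s.Circ → M)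
    (g : s'.Circ → M) (hfg : ∀ c, ¬ s.Touches x c → f c = g (h.transport c)) :
    ∑ c with ¬ s.Touches x c, f c = ∑ c with ¬ s'.Touches x c, g c := by
  refine Finset.sum_bij' (fun c _ => h.transport c) (fun c _ => h.symm.transport c) ?_ ?_ ?_ ?_ ?_
  · intro c hc
    simpa [h.touches_transport] using hc
  · intro c hc
    simpa [h.symm.touches_transport] using hc
  · intro c hc
    exact h.transport_transport (by simpa using hc)
  · intro c hc
    exact h.symm.transport_transport (by simpa using hc)
  · intro c hc
    exact hfg c (by simpa using hc)

open Classical in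
theorem sum_circ {M : Type*} [AddCommMonoid M] (s : D.State) (x : Fin D.numCrossings)
    (f : s.Circ → M) :
    ∑ c, f c = (if s.circ (x, 0) = s.circ (x, 2) then f (s.circ (x, 0))
      else f (s.circ (x, 0)) + f (s.circ (x, 2))) + ∑ c with ¬ s.Touches x c, f c := by
  rw [← Finset.sum_filter_add_sum_filter_not Finset.univ (fun c => s.Touches x c)]
  congr 1
  have : (Finset.univ.filter fun c => s.Touches x c) = {s.circ (x, 0), s.circ (x, 2)} := by
    ext c
    rw [Finset.mem_filter]
    simp [State.Touches]
  rw [this]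
  split_ifs with hx
  · rw [← hx, Finset.pair_eq_singleton, Finset.sum_singleton]
  · rw [Finset.sum_pair hx]

/-- Merging two circles decreases the number of circles by one. -/
theorem card_merge (h : s.DifferAt s' x) (hx : s.circ (x, 0) ≠ s.circ (x, 2))
    (hx' : s'.circ (x, 0) = s'.circ (x, 2)) :
    Fintype.card s.Circ = Fintype.card s'.Circ + 1 := by
  have h1 := sum_circ s x (fun _ => 1)
  have h2 := sum_circ s' x (fun _ => 1)
  have h3 := h.sum_not_touches (fun _ => 1) (fun _ => 1) fun _ _ => rfl
  rw [if_neg hx] at h1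
  rw [if_pos hx'] at h2
  simp only [Finset.sum_const, Finset.card_univ, smul_eq_mul, mul_one] at h1 h2 h3
  omega

end DifferAt

end State

end LinkDiagram

/-! ### Pants relations -/

/-- In a triple of classes of this kind, if one is trivial then the other two are equal. Such are
the classes of the boundary curves of a pair of pants. -/
structure IsPants {A : Type*} [Zero A] (a b c : A) : Prop where
  left : a = 0 → b = c
  right : b = 0 → a = c
  outer : c = 0 → a = b

theorem isPants_loopGrade {S : Type*} [TopologicalSpace S] {p : S}
    (u v : FundamentalGroup S p) :
    IsPants (loopGrade u) (loopGrade v) (loopGrade (v * u)) := by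
  refine ⟨fun h => ?_, fun h => ?_, fun h => ?_⟩ <;> rw [loopGrade_eq_zero_iff] at h
  · rw [h, mul_one]
  · rw [h, one_mul]
  · rw [eq_inv_of_mul_eq_one_left h, loopGrade_inv]

/-- The weight of `a - b - c` is at most `0`, with equality only if `a - b - c = 0`. -/
theorem weight_le_of_isPants {A : Type*} [AddCommGroup A] (w : A →+ ℤ) {a b c : A}
    (ha : (a = 0 ∧ w a = 0) ∨ (a ≠ 0 ∧ w a = 1)) (hb : (b = 0 ∧ w b = 0) ∨ (b ≠ 0 ∧ w b = 1))
    (hc : (c = 0 ∧ w c = 0) ∨ (c ≠ 0 ∧ w c = 1)) (h : IsPants a b c) :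
    (w c ≤ w a + w b ∧ (w c = w a + w b → c = a + b)) ∧
    (w a ≤ w b + w c ∧ (w a = w b + w c → a = b + c)) ∧
    (w b ≤ w a + w c ∧ (w b = w a + w c → b = a + c)) := by
  obtain ⟨h1, h2, h3⟩ := h
  -- Exactly one nontrivial class is excluded by `IsPants`. With two, these are equal; with three,
  -- `1 < 1 + 1` and the equality clauses are vacuous.
  rcases ha with ⟨ha, ha'⟩ | ⟨ha, ha'⟩ <;> rcases hb with ⟨hb, hb'⟩ | ⟨hb, hb'⟩ <;>
    rcases hc with ⟨hc, hc'⟩ | ⟨hc, hc'⟩ <;> simp_all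

namespace LinkDiagram

/-! ### Homotopy classes of circles -/

variable {S : Type*} [TopologicalSpace S] [ChartedSpace (EuclideanSpace ℝ (Fin 2)) S]
  {o : SurfaceOrientation S} (D : LinkDiagram o)

/-- A segment in the closed unit disc. -/
def discSegment (i j : Fin 4) :
    Path (⟨slotPoint i, slotPoint_mem i⟩ : Metric.closedBall (0 : EuclideanSpace ℝ (Fin 2)) 1)
      ⟨slotPoint j, slotPoint_mem j⟩ where
  toFun t := ⟨AffineMap.lineMap (slotPoint i) (slotPoint j) (t : ℝ),
    (convex_closedBall _ _).lineMap_mem (slotPoint_mem i) (slotPoint_mem j) t.2⟩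
  continuous_toFun := by
    refine Continuous.subtype_mk ?_ _
    exact AffineMap.lineMap_continuous.comp continuous_subtype_val
  source' := by simp
  target' := by simp

/-- The parametrization of the closed disc at a crossing. -/
def discMap (x : Fin D.numCrossings) :
    C(Metric.closedBall (0 : EuclideanSpace ℝ (Fin 2)) 1, S) where
  toFun z := (D.chart x).symm z
  continuous_toFun := (D.chart x).continuousOn_symm.comp_continuous continuous_subtype_val
    fun z => D.ball_subset x z.2

/-- Both paths come from the closed disc, which is contractible. -/
theorem chord_trans_homotopic (x : Fin D.numCrossings) (i j k : Fin 4) :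
    ((D.chord x i j).trans (D.chord x j k)).Homotopic (D.chord x i k) := by
  have : ContractibleSpace (Metric.closedBall (0 : EuclideanSpace ℝ (Fin 2)) 1) :=
    (convex_closedBall _ _).contractibleSpace (Metric.nonempty_closedBall.2 zero_le_one)
  have h := (SimplyConnectedSpace.paths_homotopic ((discSegment i j).trans (discSegment j k))
    (discSegment i k)).map (D.discMap x)
  rw [Path.map_trans] at h
  exact h

/-- Paths from a base point to all ends can be chosen such that the holonomies of the chords at the
crossings are trivial. -/
theorem exists_transports [PathConnectedSpace S] (p : S) :
    ∃ t : ∀ e : D.End, Path p (D.pt e),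
      ∀ x i j, holonomy (t (x, i)) (t (x, j)) (D.chord x i j) = 1 := by
  let t₀ : ∀ x, Path p (D.pt (x, 0)) := fun x => PathConnectedSpace.somePath _ _
  refine ⟨fun e => (t₀ e.1).trans (D.chord e.1 0 e.2), fun x i j => ?_⟩
  have h := holonomy_trans (t₀ x) ((t₀ x).trans (D.chord x 0 i)) ((t₀ x).trans (D.chord x 0 j))
    (D.chord x 0 i) (D.chord x i j)
  rw [holonomy_congr _ _ (D.chord_trans_homotopic x 0 i j), holonomy_trans_self,
    holonomy_trans_self, mul_one] at h
  exact h.symm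

variable {D}

/-- The end `f` is a variable because `D.opp (D.opp e)` is equal to `e` only propositionally. -/
theorem holonomy_of_eq_symm {p : S} (t : ∀ e : D.End, Path p (D.pt e)) {e e' f : D.End}
    (h : f = e) (γ : Path (D.pt e) (D.pt e')) (δ : Path (D.pt e') (D.pt f))
    (hδ : ∀ u, δ u = γ (unitInterval.symm u)) :
    holonomy (t e') (t f) δ = (holonomy (t e) (t e') γ)⁻¹ := by
  subst h
  rw [← holonomy_symm]
  congr 1
  ext u
  exact hδ u

theorem holonomy_cast {p : S} (t : ∀ e : D.End, Path p (D.pt e)) {e f : D.End} (h : f = e)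
    (γ : Path (D.pt e) (D.pt f)) (h' : D.pt e = D.pt f) :
    holonomy (t e) (t e) (γ.cast rfl h') = holonomy (t e) (t f) γ := by
  subst h
  rfl

theorem holonomy_step {p : S} {t : ∀ e : D.End, Path p (D.pt e)}
    (ht : ∀ x i j, holonomy (t (x, i)) (t (x, j)) (D.chord x i j) = 1) (s : D.State) (e : D.End) :
    holonomy (t e) (t (s.next e)) (s.step e) = holonomy (t e) (t (D.opp e)) (D.arc e) := by
  refine (holonomy_trans (t e) (t (D.opp e)) (t (s.next e)) (D.arc e)
    (D.chord (D.opp e).1 (D.opp e).2 (joined (s (D.opp e).1) (D.opp e).2))).trans ?_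
  exact (congrArg (· * _) (ht _ _ _)).trans (one_mul _)

theorem holonomy_walk {p : S} {t : ∀ e : D.End, Path p (D.pt e)}
    (ht : ∀ x i j, holonomy (t (x, i)) (t (x, j)) (D.chord x i j) = 1) (s : D.State) (n : ℕ)
    (e : D.End) : holonomy (t e) (t (s.next^[n] e)) (s.walk n e) =
      orbitWord (fun e => holonomy (t e) (t (D.opp e)) (D.arc e)) s.next n e := by
  induction n generalizing e with
  | zero => exact holonomy_refl _
  | succ n ih =>
    rw [orbitWord, ← ih, ← holonomy_step ht s]
    exact holonomy_trans _ _ _ _ _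

variable (D)

/-- The circles of all states are described by words in the fundamental group with one letter for
each edge. -/
theorem exists_letters [PathConnectedSpace S] (p : S) :
    ∃ a : D.End → FundamentalGroup S p, (∀ e, a (D.opp e) = (a e)⁻¹) ∧
      ∀ (s : D.State) (e : D.End),
        (closedPathLoop (s.loop e)).grade = loopGrade (cycleWord a s.next e) := by
  obtain ⟨t, ht⟩ := D.exists_transports p
  refine ⟨fun e => holonomy (t e) (t (D.opp e)) (D.arc e), fun e => ?_, fun s e => ?_⟩
  · exact holonomy_of_eq_symm t (D.opp_opp e) _ _ (D.arc_opp e)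
  · rw [← loopGrade_holonomy (t e), cycleWord, ← holonomy_walk ht, State.loop,
      holonomy_cast t (Function.iterate_minimalPeriod)]

variable {D}

namespace State

/-- Passing from `e` to `s.join e` reverses the circle and inverts its word, while passing to
`s.next e` conjugates it. The move `D.opp` is a combination of these two. -/
theorem loopGrade_cycleWord_eq {p : S} {a : D.End → FundamentalGroup S p}
    (ha : ∀ e, a (D.opp e) = (a e)⁻¹) {s : D.State} {e f : D.End} (h : s.circ e = s.circ f) :
    loopGrade (cycleWord a s.next e) = loopGrade (cycleWord a s.next f) := by
  have hjoin : ∀ e, loopGrade (cycleWord a s.next (s.join e)) =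
      loopGrade (cycleWord a s.next e) := fun e => by
    rw [cycleWord_reverse s.next_join_next (fun e => ?_) s.join_join, loopGrade_inv]
    rw [State.next, join_join, ha]
  refine apply_eq_of_circ_eq (fun e => loopGrade (cycleWord a s.next e)) (fun e => ?_) hjoin h
  rw [← hjoin]
  change loopGrade (cycleWord a s.next (s.next e)) = _
  rw [cycleWord_apply a (s.mem_periodicPts_next e), loopGrade_mul_comm, inv_mul_cancel_left]

theorem grade_param_circ {p : S} {a : D.End → FundamentalGroup S p}
    (ha : ∀ e, a (D.opp e) = (a e)⁻¹)
    (h : ∀ (s : D.State) (e : D.End),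
        (closedPathLoop (s.loop e)).grade = loopGrade (cycleWord a s.next e))
    (s : D.State) (e : D.End) :
    (s.param (s.circ e)).grade = loopGrade (cycleWord a s.next e) := by
  rw [State.circ, State.param, h]
  refine loopGrade_cycleWord_eq ha ?_
  rw [State.circ, Quot.out_eq]
  rfl

theorem DifferAt.grade_eq_of_not_touches [PathConnectedSpace S] {s s' : D.State}
    {x : Fin D.numCrossings} (h : s.DifferAt s' x) {c : s.Circ} (hc : ¬ s.Touches x c) :
    (s.param c).grade = (s'.param (h.transport c)).grade := by
  obtain ⟨e, rfl⟩ := s.circOf_surjective c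
  rw [h.transport_circOf hc]
  cases e with
  | inr k => rfl
  | inl e =>
    obtain ⟨a, ha, hg⟩ := D.exists_letters (D.pt e)
    rw [circOf_inl, circOf_inl, grade_param_circ ha hg, grade_param_circ ha hg, h.cycleWord_eq a hc]

theorem DifferAt.isPants [PathConnectedSpace S] (ss : D.SourceSink) {s s' : D.State}
    {x : Fin D.numCrossings} (h : s.DifferAt s' x) (hx : s.circ (x, 0) ≠ s.circ (x, 2)) :
    IsPants (s.param (s.circ (x, 0))).grade (s.param (s.circ (x, 2))).grade
      (s'.param (s'.circ (x, 0))).grade := by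
  obtain ⟨a, ha, hg⟩ := D.exists_letters (D.pt (x, 0))
  obtain ⟨-, p, q, h0, h2, h3, h4⟩ := h.merge a ss hx
  rw [← h0, ← h2, ← h3, grade_param_circ ha hg, grade_param_circ ha hg, grade_param_circ ha hg, h4]
  exact isPants_loopGrade _ _

theorem gradeWeight_grade_param (s : D.State) (c : s.Circ) :
    ((s.param c).grade = 0 ∧ gradeWeight (s.param c).grade = 0) ∨
      ((s.param c).grade ≠ 0 ∧ gradeWeight (s.param c).grade = 1) := by
  rw [gradeWeight_grade_eq]
  split_ifs with h
  exacts [Or.inl ⟨h, rfl⟩, Or.inr ⟨h, rfl⟩]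

end State

end LinkDiagram

/-! ### The structure constants of `m` and `Δ` -/

/-- With `v₊` as `true`, `m` is conjunction apart from `v₋ v₋ = 0`. Dually, the nonzero entries of
`Δ` have input the disjunction of the outputs, with `v₊ ⊗ v₊` excluded. -/
theorem repr_mMap (p q r : Bool) : vBasis.repr (mMap (vBasis p ⊗ₜ vBasis q)) r =
    if (p || q) = true ∧ r = (p && q) then 1 else 0 := by
  rw [← Module.Basis.tensorProduct_apply, mMap, Module.Basis.constr_basis]
  cases p <;> cases q <;> simp [Finsupp.single_apply]

theorem repr_deltaMap (p q r : Bool) :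
    (vBasis.tensorProduct vBasis).repr (deltaMap (vBasis p)) (q, r) =
      if (q && r) = false ∧ p = (q || r) then 1 else 0 := by
  rw [deltaMap, Module.Basis.constr_basis]
  cases p <;> cases q <;> cases r <;> simp

/-! ### Matrix entries of the partial differentials and the change of weight -/

namespace LinkDiagram

variable {S : Type*} [TopologicalSpace S] [ChartedSpace (EuclideanSpace ℝ (Fin 2)) S]
  {o : SurfaceOrientation S} {D : LinkDiagram o}

namespace State

open Classical in
theorem partialCoeff_of_merge {s : D.State} {x : Fin D.numCrossings}
    (h : s.circ (x, 0) ≠ s.circ (x, 2))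
    (h' : (s.switch x).circ (x, 0) = (s.switch x).circ (x, 2))
    (a : s.Circ → Bool) (b : (s.switch x).Circ → Bool) :
    s.partialCoeff x a b = if s.SameAway x a b ∧
      (a (s.circ (x, 0)) || a (s.circ (x, 2))) = true ∧
        b ((s.switch x).circ (x, 0)) = (a (s.circ (x, 0)) && a (s.circ (x, 2))) then 1 else 0 := by
  by_cases hS : s.SameAway x a b <;> simp [State.partialCoeff, hS, h, h', repr_mMap]

open Classical in
theorem partialCoeff_of_split {s : D.State} {x : Fin D.numCrossings}
    (h : s.circ (x, 0) = s.circ (x, 2))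
    (h' : (s.switch x).circ (x, 0) ≠ (s.switch x).circ (x, 2))
    (a : s.Circ → Bool) (b : (s.switch x).Circ → Bool) :
    s.partialCoeff x a b = if s.SameAway x a b ∧
      (b ((s.switch x).circ (x, 0)) && b ((s.switch x).circ (x, 2))) = false ∧
        a (s.circ (x, 0)) = (b ((s.switch x).circ (x, 0)) || b ((s.switch x).circ (x, 2)))
      then 1 else 0 := by
  by_cases hS : s.SameAway x a b <;> simp [State.partialCoeff, hS, h, h', repr_deltaMap]

theorem SameAway.eq_transport {s : D.State} {x : Fin D.numCrossings} (hd : s.DifferAt (s.switch x) x)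
    {a : s.Circ → Bool} {b : (s.switch x).Circ → Bool} (h : s.SameAway x a b) {c : s.Circ}
    (hc : ¬ s.Touches x c) : a c = b (hd.transport c) := by
  obtain ⟨e, rfl⟩ := s.circOf_surjective c
  rw [hd.transport_circOf hc]
  exact (s.sameAway_iff x a b).1 h e hc

end State

/-- The Khovanov differential does not increase the weight of the homotopical grading, and it
preserves the grading where it preserves the weight. -/
theorem weight_hgrade_le [PathConnectedSpace S] (ss : D.SourceSink) {s : D.State}
    {x : Fin D.numCrossings} (hs : s x = false) {a : s.Circ → Bool}
    {b : (s.switch x).Circ → Bool} (hab : s.partialCoeff x a b ≠ 0) :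
    gradeWeight (D.hgrade ⟨s.switch x, b⟩) ≤ gradeWeight (D.hgrade ⟨s, a⟩) ∧
      (gradeWeight (D.hgrade ⟨s.switch x, b⟩) = gradeWeight (D.hgrade ⟨s, a⟩) →
        D.hgrade ⟨s.switch x, b⟩ = D.hgrade ⟨s, a⟩) := by
  classical
  have hd := State.differAt_switch hs
  have haway : s.SameAway x a b := by
    by_contra h
    exact hab (if_neg h)
  have h1 : D.hgrade ⟨s, a⟩ = _ :=
    State.DifferAt.sum_circ s x fun c => vdeg (a c) • (s.param c).grade
  have h2 : D.hgrade ⟨s.switch x, b⟩ = _ :=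
    State.DifferAt.sum_circ (s.switch x) x fun c => vdeg (b c) • ((s.switch x).param c).grade
  -- Circles away from `x` contribute the same sum on both sides, so only the pants at `x` matter.
  have h3 := hd.sum_not_touches (fun c => vdeg (a c) • (s.param c).grade)
    (fun c => vdeg (b c) • ((s.switch x).param c).grade) fun c hc => by
      rw [haway.eq_transport hd hc, hd.grade_eq_of_not_touches hc]
  rw [h1, h2, ← h3]
  generalize ∑ c with ¬ s.Touches x c, vdeg (a c) • (s.param c).grade = R
  rw [map_add, map_add, add_le_add_iff_right, add_left_inj, add_left_inj]
  have w0 := s.gradeWeight_grade_param (s.circ (x, 0))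
  have w2 := s.gradeWeight_grade_param (s.circ (x, 2))
  have w0' := (s.switch x).gradeWeight_grade_param ((s.switch x).circ (x, 0))
  have w2' := (s.switch x).gradeWeight_grade_param ((s.switch x).circ (x, 2))
  by_cases hx : s.circ (x, 0) = s.circ (x, 2)
  · have hx' := hd.split ss hx
    obtain ⟨⟨k1, k2⟩, ⟨k3, k4⟩, k5, k6⟩ :=
      weight_le_of_isPants gradeWeight w0' w2' w0 (hd.symm.isPants ss hx')
    rw [State.partialCoeff_of_split hx hx'] at hab
    obtain ⟨-, hm, hm'⟩ := (ite_ne_right_iff.1 hab).1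
    rw [if_pos hx, if_neg hx', hm']
    generalize (s.param (s.circ (x, 0))).grade = g at *
    generalize ((s.switch x).param ((s.switch x).circ (x, 0))).grade = g0 at *
    generalize ((s.switch x).param ((s.switch x).circ (x, 2))).grade = g2 at *
    -- The three nonzero entries of `Δ` correspond to the three triangle inequalities for the
    -- weights of the pants; `v₋ ↦ v₋ ⊗ v₋`, for instance, needs `w g ≤ w g0 + w g2`. The same
    -- happens for `m` below.
    cases hb0 : b ((s.switch x).circ (x, 0)) <;> cases hb2 : b ((s.switch x).circ (x, 2)) <;>
      simp only [hb0, hb2] at hm <;>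
      simp only [vdeg, Bool.or_true, Bool.or_false, Bool.or_self, if_true, Bool.false_eq_true,
        if_false, one_smul, neg_smul, map_add, map_neg]
    · exact ⟨by linarith, fun h => by rw [k2 (by linarith)]; abel⟩
    · exact ⟨by linarith, fun h => by rw [k6 (by linarith)]; abel⟩
    · exact ⟨by linarith, fun h => by rw [k4 (by linarith)]; abel⟩
    · cases hm
  · have hx' := (hd.circ_eq_iff ss).2 hx
    obtain ⟨⟨k1, k2⟩, ⟨k3, k4⟩, k5, k6⟩ :=
      weight_le_of_isPants gradeWeight w0 w2 w0' (hd.isPants ss hx)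
    rw [State.partialCoeff_of_merge hx hx'] at hab
    obtain ⟨-, hm, hm'⟩ := (ite_ne_right_iff.1 hab).1
    rw [if_neg hx, if_pos hx', hm']
    generalize ((s.switch x).param ((s.switch x).circ (x, 0))).grade = g at *
    generalize (s.param (s.circ (x, 0))).grade = g0 at *
    generalize (s.param (s.circ (x, 2))).grade = g2 at *
    cases hb0 : a (s.circ (x, 0)) <;> cases hb2 : a (s.circ (x, 2)) <;>
      simp only [hb0, hb2] at hm <;>
      simp only [vdeg, Bool.and_true, Bool.and_false, Bool.and_self, if_true, Bool.false_eq_true,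
        if_false, one_smul, neg_smul, map_add, map_neg]
    · cases hm
    · exact ⟨by linarith, fun h => by rw [k4 (by linarith)]; abel⟩
    · exact ⟨by linarith, fun h => by rw [k6 (by linarith)]; abel⟩
    · exact ⟨by linarith, fun h => by rw [k2 (by linarith)]⟩

end LinkDiagram

/-! ### One operator per crossing, and the multiplications by `v₋` -/

namespace LinkDiagram

variable {S : Type*} [TopologicalSpace S] [ChartedSpace (EuclideanSpace ℝ (Fin 2)) S]
  {o : SurfaceOrientation S} {D : LinkDiagram o}

theorem chainBasis_apply (s : D.State) (a : s.Circ → Bool) :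
    D.chainBasis ⟨s, a⟩ = DirectSum.lof (ZMod 2) D.State State.space s (s.basis a) := by
  refine D.chainBasis.repr.injective ?_
  rw [Module.Basis.repr_self]
  ext ⟨s', b⟩
  change _ = (s'.basis).repr ((DFinsupp.single s (s.basis a) : D.Chains) s') b
  classical
  by_cases hs : s' = s
  · subst hs
    rw [DFinsupp.single_eq_same, Module.Basis.repr_self, Finsupp.single_apply, Finsupp.single_apply]
    exact if_congr (by simp) rfl rfl
  · rw [DFinsupp.single_eq_of_ne hs, map_zero, Finsupp.zero_apply,
      Finsupp.single_eq_of_ne fun h => hs (congrArg Sigma.fst h)]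

variable (D)

/-- The sum of the partial differentials over all edges of the state cube which change the
resolution at `x`. -/
def crossingMap (x : Fin D.numCrossings) : D.Chains →ₗ[ZMod 2] D.Chains :=
  D.chainBasis.constr (ZMod 2) fun α =>
    if α.1 x = false then
      ∑ b, α.1.partialCoeff x α.2 b • D.chainBasis ⟨α.1.switch x, b⟩
    else 0

/-- Multiplication by `v₋` in the factor of the circle given by `e`, where `V` is identified with
`ℤ₂[v₋] / v₋²`. -/
def mulMinus (e : D.End ⊕ Fin D.numFree) : D.Chains →ₗ[ZMod 2] D.Chains :=
  D.chainBasis.constr (ZMod 2) fun α =>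
    if α.2 (α.1.circOf e) = true then
      D.chainBasis ⟨α.1, Function.update α.2 (α.1.circOf e) false⟩
    else 0

theorem crossingMap_basis (x : Fin D.numCrossings) (s : D.State) (a : s.Circ → Bool) :
    D.crossingMap x (D.chainBasis ⟨s, a⟩) =
      if s x = false then ∑ b, s.partialCoeff x a b • D.chainBasis ⟨s.switch x, b⟩ else 0 :=
  Module.Basis.constr_basis _ _ _ _

theorem mulMinus_basis (e : D.End ⊕ Fin D.numFree) (s : D.State) (a : s.Circ → Bool) :
    D.mulMinus e (D.chainBasis ⟨s, a⟩) = if a (s.circOf e) = true then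
      D.chainBasis ⟨s, Function.update a (s.circOf e) false⟩ else 0 :=
  Module.Basis.constr_basis _ _ _ _

theorem d_eq_sum_crossingMap : D.d = ∑ x, D.crossingMap x := by
  refine D.chainBasis.ext fun ⟨s, a⟩ => ?_
  rw [chainBasis_apply, d, LinearMap.sum_apply, LinearMap.sum_apply]
  let F : D.State × Fin D.numCrossings → D.Chains := fun e =>
    DirectSum.lof (ZMod 2) D.State State.space (e.1.switch e.2) (e.1.partialMap e.2
      (DirectSum.component (ZMod 2) D.State State.space e.1
        (DirectSum.lof (ZMod 2) D.State State.space s (s.basis a))))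
  have hF : ∑ e : {e : D.State × Fin D.numCrossings // e.1 e.2 = false}, F e =
      ∑ e with e.1 e.2 = false, F e :=
    (Finset.sum_subtype _ (fun e => by simp) F).symm
  refine hF.trans ?_
  rw [Finset.sum_filter, Fintype.sum_prod_type, Finset.sum_eq_single s]
  · refine Finset.sum_congr rfl fun x _ => ?_
    rw [← chainBasis_apply, crossingMap_basis]
    refine if_congr Iff.rfl ?_ rfl
    simp only [F, DirectSum.component.lof_self, State.partialMap, Module.Basis.constr_basis,
      map_sum, map_smul, chainBasis_apply]
  · intro s' _ hs'
    refine Finset.sum_eq_zero fun x _ => ?_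
    have : DirectSum.component (ZMod 2) D.State State.space s'
        (DirectSum.lof (ZMod 2) D.State State.space s (s.basis a)) = 0 := by
      rw [DirectSum.component.of, dif_neg hs'.symm]
    simp [F, this]
  · simp

theorem mulMinus_comm (e f : D.End ⊕ Fin D.numFree) :
    D.mulMinus e ∘ₗ D.mulMinus f = D.mulMinus f ∘ₗ D.mulMinus e := by
  refine D.chainBasis.ext fun ⟨s, a⟩ => ?_
  simp only [LinearMap.comp_apply, mulMinus_basis]
  by_cases hef : s.circOf e = s.circOf f
  · split_ifs <;> simp [mulMinus_basis, hef]
  · have h1 : Function.update (Function.update a (s.circOf f) false) (s.circOf e) false =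
        Function.update (Function.update a (s.circOf e) false) (s.circOf f) false :=
      (Function.update_comm hef _ _ _).symm
    by_cases he : a (s.circOf e) = true <;> by_cases hf : a (s.circOf f) = true <;>
      simp [he, hf, mulMinus_basis, hef, Ne.symm hef, h1]

/-- The tensor all of whose factors are `v₊`. -/
def allPlus (s : D.State) : D.Chains := D.chainBasis ⟨s, fun _ => true⟩

theorem mulMinus_allPlus (e : D.End ⊕ Fin D.numFree) (s : D.State) :
    D.mulMinus e (D.allPlus s) =
      D.chainBasis ⟨s, Function.update (fun _ => true) (s.circOf e) false⟩ := by
  simp [allPlus, mulMinus_basis]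

variable {D}

/-- Linear maps which commute with the multiplications by `v₋` are determined by their values on the
tensors all of whose factors are `v₊`. -/
theorem ext_allPlus {f g : D.Chains →ₗ[ZMod 2] D.Chains}
    (hf : ∀ e, f ∘ₗ D.mulMinus e = D.mulMinus e ∘ₗ f)
    (hg : ∀ e, g ∘ₗ D.mulMinus e = D.mulMinus e ∘ₗ g)
    (h : ∀ s, f (D.allPlus s) = g (D.allPlus s)) : f = g := by
  refine D.chainBasis.ext fun ⟨s, a⟩ => ?_
  induction hn : (Finset.univ.filter fun c => a c = false).card generalizing a with
  | zero =>
    rw [Finset.card_eq_zero, Finset.filter_eq_empty_iff] at hn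
    obtain rfl : a = fun _ => true := funext fun c => by simpa using hn (Finset.mem_univ c)
    exact h s
  | succ n ih =>
    have hpos : 0 < (Finset.univ.filter fun c => a c = false).card := by omega
    obtain ⟨c, hc⟩ := Finset.card_pos.1 hpos
    have hc' : a c = false := (Finset.mem_filter.1 hc).2
    obtain ⟨e, rfl⟩ := s.circOf_surjective c
    have ha : D.chainBasis ⟨s, a⟩ = D.mulMinus e
        (D.chainBasis ⟨s, Function.update a (s.circOf e) true⟩) := by
      simp [mulMinus_basis, ← hc']
    have hcard : (Finset.univ.filter fun c => Function.update a (s.circOf e) true c = false) =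
        (Finset.univ.filter fun c => a c = false).erase (s.circOf e) := by
      ext c
      by_cases hce : c = s.circOf e <;> simp [hce]
    have hi := ih (Function.update a (s.circOf e) true) (by
      rw [hcard, Finset.card_erase_of_mem hc, hn]; rfl)
    rw [ha, ← LinearMap.comp_apply, ← LinearMap.comp_apply, hf, hg, LinearMap.comp_apply,
      LinearMap.comp_apply, hi]

end LinkDiagram

/-! ### The crossing operators commute with the multiplications by `v₋` -/

namespace LinkDiagram

variable {S : Type*} [TopologicalSpace S] [ChartedSpace (EuclideanSpace ℝ (Fin 2)) S]
  {o : SurfaceOrientation S} {D : LinkDiagram o}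

namespace State

variable {s : D.State} {x : Fin D.numCrossings}

theorem sameAway_update_of_touches (hd : s.DifferAt (s.switch x) x) {a : s.Circ → Bool}
    {b : (s.switch x).Circ → Bool} {c : s.Circ} {c' : (s.switch x).Circ} (hc : s.Touches x c)
    (hc' : (s.switch x).Touches x c') (u v : Bool) :
    s.SameAway x (Function.update a c u) (Function.update b c' v) ↔ s.SameAway x a b := by
  rw [sameAway_iff, sameAway_iff]
  refine forall_congr' fun f => forall_congr' fun hf => ?_
  have hf' := mt hd.touches_circOf_iff.1 hf
  rw [Function.update_of_ne (fun h => hf (by rw [h]; exact hc)),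
    Function.update_of_ne (fun h => hf' (by rw [h]; exact hc'))]

theorem sameAway_update_of_not_touches (hd : s.DifferAt (s.switch x) x) {a : s.Circ → Bool}
    {b : (s.switch x).Circ → Bool} {e : D.End ⊕ Fin D.numFree}
    (he : ¬ s.Touches x (s.circOf e)) :
    (a (s.circOf e) = true ∧ s.SameAway x (Function.update a (s.circOf e) false) b) ↔
      (b ((s.switch x).circOf e) = false ∧
        s.SameAway x a (Function.update b ((s.switch x).circOf e) true)) := by
  rw [sameAway_iff, sameAway_iff]
  have key : ∀ f, ¬ s.Touches x (s.circOf f) →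
      (s.circOf f = s.circOf e ↔ (s.switch x).circOf f = (s.switch x).circOf e) := fun f hf =>
    ⟨hd.circOf_eq_of_not_touches hf,
      hd.symm.circOf_eq_of_not_touches (mt hd.touches_circOf_iff.1 hf)⟩
  constructor
  · rintro ⟨ha, h⟩
    refine ⟨by simpa using (h e he).symm, fun f hf => ?_⟩
    by_cases hfe : s.circOf f = s.circOf e
    · rw [hfe, (key f hf).1 hfe, ha, Function.update_self]
    · rw [Function.update_of_ne (mt (key f hf).2 hfe), ← h f hf, Function.update_of_ne hfe]
  · rintro ⟨hb, h⟩
    refine ⟨by simpa using h e he, fun f hf => ?_⟩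
    by_cases hfe : s.circOf f = s.circOf e
    · rw [hfe, (key f hf).1 hfe, hb, Function.update_self]
    · rw [Function.update_of_ne hfe, h f hf, Function.update_of_ne (mt (key f hf).2 hfe)]

/-- The two sides are the matrix entries of `crossingMap` after and before `mulMinus`. Near `x` the
equality says that `m` and `Δ` are linear over `ℤ₂[v₋] / v₋²`; away from `x` the label is simply
carried along. -/
theorem partialCoeff_update (ss : D.SourceSink) (hs : s x = false) (a : s.Circ → Bool)
    (b : (s.switch x).Circ → Bool) (e : D.End ⊕ Fin D.numFree) :
    (if a (s.circOf e) = true then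
      s.partialCoeff x (Function.update a (s.circOf e) false) b else 0) =
    if b ((s.switch x).circOf e) = false then
      s.partialCoeff x a (Function.update b ((s.switch x).circOf e) true) else 0 := by
  classical
  have hd := differAt_switch hs
  by_cases he : s.Touches x (s.circOf e)
  · have he' := hd.touches_circOf_iff.2 he
    have h1 : s.SameAway x (Function.update a (s.circOf e) false) b ↔ s.SameAway x a b := by
      simpa using sameAway_update_of_touches hd (a := a) (b := b) he he' false
        (b ((s.switch x).circOf e))
    have h2 : s.SameAway x a (Function.update b ((s.switch x).circOf e) true) ↔
        s.SameAway x a b := by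
      simpa using sameAway_update_of_touches hd (a := a) (b := b) he he' (a (s.circOf e)) true
    by_cases hx : s.circ (x, 0) = s.circ (x, 2)
    · have hx' := hd.split ss hx
      rw [partialCoeff_of_split hx hx', partialCoeff_of_split hx hx', h1, h2]
      have hce : s.circOf e = s.circ (x, 0) := by
        rcases he with h | h
        exacts [h, h.trans hx.symm]
      rw [hce]
      rcases he' with h | h <;> rw [h] <;>
        cases a (s.circ (x, 0)) <;> cases hb0 : b ((s.switch x).circ (x, 0)) <;>
        cases hb2 : b ((s.switch x).circ (x, 2)) <;> simp [hx', hx'.symm, hb0, hb2]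
    · have hx' := (hd.circ_eq_iff ss).2 hx
      rw [partialCoeff_of_merge hx hx', partialCoeff_of_merge hx hx', h1, h2]
      have hce : (s.switch x).circOf e = (s.switch x).circ (x, 0) := by
        rcases he' with h | h
        exacts [h, h.trans hx'.symm]
      rw [hce]
      rcases he with h | h <;> rw [h] <;>
        cases ha0 : a (s.circ (x, 0)) <;> cases ha2 : a (s.circ (x, 2)) <;>
        cases b ((s.switch x).circ (x, 0)) <;> simp [hx, Ne.symm hx, ha0, ha2]
  · have he' := mt hd.touches_circOf_iff.1 he
    have h1 := sameAway_update_of_not_touches hd (a := a) (b := b) he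
    have ha : ∀ i, s.Touches x (s.circ (x, i)) →
        Function.update a (s.circOf e) false (s.circ (x, i)) = a (s.circ (x, i)) := fun i hi =>
      Function.update_of_ne (fun h => he (by rw [← h]; exact hi)) _ _
    have hb : ∀ i, (s.switch x).Touches x ((s.switch x).circ (x, i)) →
        Function.update b ((s.switch x).circOf e) true ((s.switch x).circ (x, i)) =
          b ((s.switch x).circ (x, i)) := fun i hi =>
      Function.update_of_ne (fun h => he' (by rw [← h]; exact hi)) _ _
    have ha0 := ha 0 (Or.inl rfl)
    have ha2 := ha 2 (Or.inr rfl)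
    have hb0 := hb 0 (Or.inl rfl)
    have hb2 := hb 2 (Or.inr rfl)
    by_cases hx : s.circ (x, 0) = s.circ (x, 2)
    · have hx' := hd.split ss hx
      rw [partialCoeff_of_split hx hx', partialCoeff_of_split hx hx', ← ite_and, ← ite_and, ha0, hb0, hb2]
      exact if_congr (by rw [← and_assoc, h1, and_assoc]) rfl rfl
    · have hx' := (hd.circ_eq_iff ss).2 hx
      rw [partialCoeff_of_merge hx hx', partialCoeff_of_merge hx hx', ← ite_and, ← ite_and, ha0, ha2, hb0]
      exact if_congr (by rw [← and_assoc, h1, and_assoc]) rfl rfl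

theorem sameAway_true_iff (hd : s.DifferAt (s.switch x) x) {b : (s.switch x).Circ → Bool} :
    s.SameAway x (fun _ => true) b ↔ ∀ c, ¬ (s.switch x).Touches x c → b c = true := by
  rw [sameAway_iff, (s.switch x).circOf_surjective.forall]
  exact forall_congr' fun f => by rw [hd.touches_circOf_iff, eq_comm]

theorem eq_true_iff (hd : s.DifferAt (s.switch x) x) {b : (s.switch x).Circ → Bool} :
    b = (fun _ => true) ↔ s.SameAway x (fun _ => true) b ∧
      b ((s.switch x).circ (x, 0)) = true ∧ b ((s.switch x).circ (x, 2)) = true := by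
  rw [sameAway_true_iff hd]
  constructor
  · rintro rfl
    simp
  · rintro ⟨h, h0, h2⟩
    funext c
    by_cases hc : (s.switch x).Touches x c
    · rcases hc with rfl | rfl
      exacts [h0, h2]
    · exact h c hc

theorem eq_update_false_iff (hd : s.DifferAt (s.switch x) x) {b : (s.switch x).Circ → Bool}
    {c₁ c₂ : (s.switch x).Circ} (hc : c₁ ≠ c₂) (h : ∀ c, (s.switch x).Touches x c ↔ c = c₁ ∨ c = c₂) :
    b = Function.update (fun _ => true) c₁ false ↔ s.SameAway x (fun _ => true) b ∧
      b c₁ = false ∧ b c₂ = true := by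
  rw [sameAway_true_iff hd]
  constructor
  · rintro rfl
    refine ⟨fun c hc => Function.update_of_ne (fun h' => hc ?_) _ _, by simp, by simp [hc.symm]⟩
    exact (h c).2 (Or.inl h')
  · rintro ⟨h', h1, h2⟩
    funext c
    by_cases hc1 : c = c₁
    · rw [hc1, h1, Function.update_self]
    · rw [Function.update_of_ne hc1]
      by_cases hc2 : c = c₂
      · rw [hc2, h2]
      · exact h' c fun ht => ((h c).1 ht).elim hc1 hc2

end State

/-- Reindexes the image of a sum under `mulMinus` by the resulting label, so that coefficients can
be compared. -/
theorem sum_update_false {ι M : Type*} [Fintype ι] [DecidableEq ι] [AddCommMonoid M] (c : ι)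
    (F : (ι → Bool) → (ι → Bool) → M) :
    ∑ b : ι → Bool, (if b c = true then F b (Function.update b c false) else 0) =
      ∑ b : ι → Bool, (if b c = false then F (Function.update b c true) b else 0) := by
  rw [← Finset.sum_filter, ← Finset.sum_filter]
  refine Finset.sum_bij' (fun b _ => Function.update b c false)
    (fun b _ => Function.update b c true) ?_ ?_ ?_ ?_ ?_
  · simp
  · simp
  · intro b hb
    have : b c = true := by simpa using hb
    simp [← this]
  · intro b hb
    have : b c = false := by simpa using hb
    simp [← this]
  · intro b hb
    have : b c = true := by simpa using hb
    simp [← this]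

theorem crossingMap_mulMinus (ss : D.SourceSink) (x : Fin D.numCrossings)
    (e : D.End ⊕ Fin D.numFree) :
    D.crossingMap x ∘ₗ D.mulMinus e = D.mulMinus e ∘ₗ D.crossingMap x := by
  refine D.chainBasis.ext fun ⟨s, a⟩ => ?_
  rw [LinearMap.comp_apply, LinearMap.comp_apply, mulMinus_basis, crossingMap_basis]
  by_cases hs : s x = false
  · rw [if_pos hs, map_sum]
    simp only [map_smul, mulMinus_basis, smul_ite, smul_zero]
    have key := sum_update_false ((s.switch x).circOf e)
      fun b b' => s.partialCoeff x a b • D.chainBasis ⟨s.switch x, b'⟩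
    refine Eq.trans ?_ key.symm
    have h2 : ∀ b : (s.switch x).Circ → Bool, (if b ((s.switch x).circOf e) = false then
        s.partialCoeff x a (Function.update b ((s.switch x).circOf e) true) •
          D.chainBasis ⟨s.switch x, b⟩ else 0) =
        (if a (s.circOf e) = true then
          s.partialCoeff x (Function.update a (s.circOf e) false) b else 0) •
          D.chainBasis ⟨s.switch x, b⟩ := fun b => by
      rw [State.partialCoeff_update ss hs, ite_smul, zero_smul]
    rw [Finset.sum_congr rfl fun b _ => h2 b]
    split_ifs
    · rw [crossingMap_basis, if_pos hs]
    · simp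
  · rw [if_neg hs, map_zero]
    split_ifs
    · rw [crossingMap_basis, if_neg hs]
    · rw [map_zero]

/-! ### Values on the all-`v₊` tensors, faces of the state cube, and `d² = 0` -/

variable (D)

/-- The sum of the multiplications by `v₋` in the two factors at the crossing `x`. -/
def mulHandle (x : Fin D.numCrossings) : D.Chains →ₗ[ZMod 2] D.Chains :=
  D.mulMinus (Sum.inl (x, 0)) + D.mulMinus (Sum.inl (x, 2))

variable {D}

open Classical in
/-- The operator whose value on the tensor with all factors `v₊` is the partial differential. -/
def State.factor (s : D.State) (x : Fin D.numCrossings) : D.Chains →ₗ[ZMod 2] D.Chains :=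
  if s.circ (x, 0) = s.circ (x, 2) then D.mulHandle x else LinearMap.id

/-- With `v₊` as unit, `m(1 ⊗ 1) = 1` and `Δ(1) = 1 ⊗ v₋ + v₋ ⊗ 1`. -/
theorem crossingMap_allPlus (ss : D.SourceSink) {s : D.State} {x : Fin D.numCrossings}
    (hs : s x = false) :
    D.crossingMap x (D.allPlus s) = s.factor x (D.allPlus (s.switch x)) := by
  classical
  have hd := State.differAt_switch hs
  rw [allPlus, crossingMap_basis, if_pos hs, State.factor]
  split_ifs with hx
  · have hx' := hd.split ss hx
    have hco : ∀ b, s.partialCoeff x (fun _ => true) b =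
        (if b = Function.update (fun _ => true) ((s.switch x).circ (x, 0)) false then 1 else 0) +
        (if b = Function.update (fun _ => true) ((s.switch x).circ (x, 2)) false then 1 else 0) := by
      intro b
      rw [State.partialCoeff_of_split hx hx']
      have h1 := State.eq_update_false_iff hd (b := b) hx' fun c => Iff.rfl
      have h2 := State.eq_update_false_iff hd (b := b) hx'.symm fun c => or_comm
      simp only [h1, h2]
      by_cases hS : s.SameAway x (fun _ => true) b <;>
        cases b ((s.switch x).circ (x, 0)) <;> cases b ((s.switch x).circ (x, 2)) <;> simp [hS]
    simp only [hco, add_smul, ite_smul, one_smul, zero_smul, Finset.sum_add_distrib,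
      Finset.sum_ite_eq', Finset.mem_univ, if_true]
    rw [mulHandle, LinearMap.add_apply, mulMinus_allPlus, mulMinus_allPlus]
    rfl
  · have hx' := (hd.circ_eq_iff ss).2 hx
    have hco : ∀ b, s.partialCoeff x (fun _ => true) b =
        if b = fun _ => true then 1 else 0 := by
      intro b
      rw [State.partialCoeff_of_merge hx hx']
      simp only [State.eq_true_iff hd (b := b), ← hx']
      simp
    simp only [hco, ite_smul, one_smul, zero_smul, Finset.sum_ite_eq', Finset.mem_univ, if_true]
    rfl

theorem State.switch_comm (s : D.State) {x y : Fin D.numCrossings} (h : x ≠ y) :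
    (s.switch x).switch y = (s.switch y).switch x :=
  Function.update_comm h.symm _ _ _ |>.symm

theorem State.switch_of_ne (s : D.State) {x y : Fin D.numCrossings} (h : y ≠ x) :
    s.switch x y = s y := by
  simp [State.switch, h]

theorem mulHandle_comm (x y : Fin D.numCrossings) (v : D.Chains) :
    D.mulHandle x (D.mulHandle y v) = D.mulHandle y (D.mulHandle x v) := by
  have h : ∀ e f, D.mulMinus e (D.mulMinus f v) = D.mulMinus f (D.mulMinus e v) := fun e f =>
    LinearMap.congr_fun (D.mulMinus_comm e f) v
  simp only [mulHandle, LinearMap.add_apply, map_add, h _ (Sum.inl (x, 0)), h _ (Sum.inl (x, 2))]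
  abel

theorem mulHandle_allPlus_eq_zero {s : D.State} {x : Fin D.numCrossings}
    (h : s.circ (x, 0) = s.circ (x, 2)) : D.mulHandle x (D.allPlus s) = 0 := by
  rw [mulHandle, LinearMap.add_apply, mulMinus_allPlus, mulMinus_allPlus, State.circOf_inl,
    State.circOf_inl, h, ← two_smul (ZMod 2), show (2 : ZMod 2) = 0 from rfl, zero_smul]

/-- Two different circles pass near `x` and both pass near `y`, so the pairs of circles at `x` and
at `y` coincide. -/
theorem mulHandle_allPlus_eq {s : D.State} {x y : Fin D.numCrossings}
    (h : s.circ (x, 0) ≠ s.circ (x, 2)) (h0 : s.Touches y (s.circ (x, 0)))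
    (h2 : s.Touches y (s.circ (x, 2))) :
    D.mulHandle x (D.allPlus s) = D.mulHandle y (D.allPlus s) := by
  simp only [mulHandle, LinearMap.add_apply, mulMinus_allPlus, State.circOf_inl]
  rcases h0 with h0 | h0 <;> rcases h2 with h2 | h2
  · exact absurd (h0.trans h2.symm) h
  · rw [h0, h2]
  · rw [h0, h2, add_comm]
  · exact absurd (h0.trans h2.symm) h

theorem crossingMap_factor (ss : D.SourceSink) (s : D.State) (x y : Fin D.numCrossings)
    (v : D.Chains) : D.crossingMap y (s.factor x v) = s.factor x (D.crossingMap y v) := by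
  rw [State.factor]
  split_ifs
  · have h := fun e => LinearMap.congr_fun (crossingMap_mulMinus ss y e) v
    simp only [LinearMap.comp_apply] at h
    rw [mulHandle, LinearMap.add_apply, map_add, h, h, LinearMap.add_apply]
  · rfl

/-- If the arcs at `y` lie on different circles before the change at `x`, and on one circle after
it, then the merged circle at `x` passes near `y`. -/
theorem State.touches_of_merge {s : D.State} {x y : Fin D.numCrossings}
    (ss : D.SourceSink) (hs : s x = false) (hx : s.circ (x, 0) ≠ s.circ (x, 2))
    (hy : s.circ (y, 0) ≠ s.circ (y, 2))
    (hy' : (s.switch x).circ (y, 0) = (s.switch x).circ (y, 2)) (i : Fin 4) :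
    (s.switch x).Touches y ((s.switch x).circ (x, i)) := by
  have hd := differAt_switch hs
  have hx' := (hd.circ_eq_iff ss).2 hx
  have ht := (((hd.circ_eq_iff_of_merge hx').1 hy').resolve_left hy).1
  exact Or.inl ((hd.circ_eq_iff_of_merge hx').2 (Or.inr ⟨s.touches_crossing x i, ht⟩))

theorem State.card_switch (ss : D.SourceSink) {s : D.State} {x : Fin D.numCrossings}
    (hs : s x = false) : (s.circ (x, 0) ≠ s.circ (x, 2) ∧
      Fintype.card s.Circ = Fintype.card (s.switch x).Circ + 1) ∨
      (s.circ (x, 0) = s.circ (x, 2) ∧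
        Fintype.card (s.switch x).Circ = Fintype.card s.Circ + 1) := by
  have hd := differAt_switch hs
  by_cases hx : s.circ (x, 0) = s.circ (x, 2)
  · exact Or.inr ⟨hx, hd.symm.card_merge (hd.split ss hx) hx⟩
  · exact Or.inl ⟨hx, hd.card_merge hx ((hd.circ_eq_iff ss).2 hx)⟩

theorem factor_factor_allPlus (ss : D.SourceSink) {s : D.State} {x y : Fin D.numCrossings}
    (hxy : x ≠ y) (hx : s x = false) (hy : s y = false) :
    s.factor x ((s.switch x).factor y (D.allPlus ((s.switch x).switch y))) =
      s.factor y ((s.switch y).factor x (D.allPlus ((s.switch y).switch x))) := by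
  have hcomm := s.switch_comm hxy
  have hxy' : (s.switch x) y = false := by rw [s.switch_of_ne hxy.symm, hy]
  have hyx' : (s.switch y) x = false := by rw [s.switch_of_ne hxy, hx]
  have hdy := State.differAt_switch hxy'
  have hdx := State.differAt_switch hyx'
  have c1 := State.card_switch ss hx
  have c2 := State.card_switch ss hxy'
  have c3 := State.card_switch ss hy
  have c4 := State.card_switch ss hyx'
  -- Both ways around the face now end in the same state. The circle counts then exclude faces whose
  -- two sides have different numbers of merges.
  rw [← hcomm] at c4 hdx ⊢
  unfold State.factor
  rcases c1 with ⟨h1, c1⟩ | ⟨h1, c1⟩ <;> rcases c2 with ⟨h2, c2⟩ | ⟨h2, c2⟩ <;>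
    rcases c3 with ⟨h3, c3⟩ | ⟨h3, c3⟩ <;> rcases c4 with ⟨h4, c4⟩ | ⟨h4, c4⟩ <;>
    first
    | omega
    | simp only [h1, h2, h3, h4, if_true, if_false, LinearMap.id_apply]
  -- Both ways merge and then split: in the final state the same two circles pass near `x` and near
  -- `y`.
  · refine (mulHandle_allPlus_eq (hdx.split ss h4) ?_ ?_).symm
    · exact hdy.touches_iff.2 (State.touches_of_merge ss hx h1 h3 h2 0)
    · exact hdy.touches_iff.2 (State.touches_of_merge ss hx h1 h3 h2 2)
  -- Both ways split and then merge back, and both give `m ∘ Δ = 0` in characteristic 2.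
  · rw [mulHandle_allPlus_eq_zero ((hdx.circ_eq_iff ss).2 h4),
      mulHandle_allPlus_eq_zero ((hdy.circ_eq_iff ss).2 h2)]
  -- Both ways split twice.
  · rw [mulHandle_comm]

theorem crossingMap_crossingMap_allPlus (ss : D.SourceSink) (s : D.State)
    (x y : Fin D.numCrossings) : D.crossingMap y (D.crossingMap x (D.allPlus s)) =
      if s x = false ∧ s y = false ∧ x ≠ y then
        s.factor x ((s.switch x).factor y (D.allPlus ((s.switch x).switch y))) else 0 := by
  by_cases hx : s x = false
  · rw [crossingMap_allPlus ss hx, crossingMap_factor ss]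
    by_cases hy : (s.switch x) y = false
    · have hxy : x ≠ y := by
        rintro rfl
        simp [State.switch] at hy
      rw [crossingMap_allPlus ss hy, if_pos ⟨hx, by rwa [s.switch_of_ne hxy.symm] at hy, hxy⟩]
    · rw [allPlus, crossingMap_basis, if_neg hy, map_zero, if_neg]
      rintro ⟨-, h, hxy⟩
      exact hy (by rwa [s.switch_of_ne hxy.symm])
  · rw [allPlus, crossingMap_basis, if_neg hx, map_zero, if_neg fun h => hx h.1]

theorem crossingMap_comm (ss : D.SourceSink) (x y : Fin D.numCrossings) :
    D.crossingMap y ∘ₗ D.crossingMap x = D.crossingMap x ∘ₗ D.crossingMap y := by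
  have h : ∀ x y e, (D.crossingMap y ∘ₗ D.crossingMap x) ∘ₗ D.mulMinus e =
      D.mulMinus e ∘ₗ (D.crossingMap y ∘ₗ D.crossingMap x) := fun x y e => by
    rw [LinearMap.comp_assoc, crossingMap_mulMinus ss, ← LinearMap.comp_assoc,
      crossingMap_mulMinus ss, LinearMap.comp_assoc]
  refine ext_allPlus (h x y) (h y x) fun s => ?_
  rw [LinearMap.comp_apply, LinearMap.comp_apply, crossingMap_crossingMap_allPlus ss,
    crossingMap_crossingMap_allPlus ss]
  by_cases hs : s x = false ∧ s y = false ∧ x ≠ y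
  · rw [if_pos hs, if_pos ⟨hs.2.1, hs.1, hs.2.2.symm⟩,
      factor_factor_allPlus ss hs.2.2 hs.1 hs.2.1]
  · rw [if_neg hs, if_neg fun h => hs ⟨h.2.1, h.1, h.2.2.symm⟩]

theorem crossingMap_self (x : Fin D.numCrossings) :
    D.crossingMap x ∘ₗ D.crossingMap x = 0 := by
  refine D.chainBasis.ext fun ⟨s, a⟩ => ?_
  rw [LinearMap.comp_apply, crossingMap_basis]
  split_ifs
  · rw [map_sum]
    refine Finset.sum_eq_zero fun b _ => ?_
    rw [map_smul, crossingMap_basis, if_neg (by simp [State.switch]), smul_zero]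
  · exact map_zero _

theorem d_comp_d (ss : D.SourceSink) : D.d ∘ₗ D.d = 0 := by
  refine LinearMap.ext fun v => ?_
  rw [LinearMap.comp_apply, d_eq_sum_crossingMap, LinearMap.sum_apply, LinearMap.sum_apply]
  simp only [map_sum]
  rw [← Finset.sum_product']
  -- The terms of `(x, y)` and `(y, x)` are equal and cancel modulo 2; the diagonal terms vanish by
  -- `crossingMap_self`.
  refine Finset.sum_involution (fun p _ => (p.2, p.1)) ?_ ?_ ?_ ?_
  · rintro ⟨x, y⟩ -
    have := LinearMap.congr_fun (crossingMap_comm ss x y) v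
    simp only [LinearMap.comp_apply] at this
    simp only [this, ← two_smul (ZMod 2), show (2 : ZMod 2) = 0 from rfl, zero_smul]
  · rintro ⟨x, y⟩ - h heq
    obtain rfl : y = x := congrArg Prod.fst heq
    exact h (LinearMap.congr_fun (crossingMap_self y) v)
  · simp
  · simp

/-! ### The part of the differential which preserves the homotopical grading -/

/-- The matrix of the Khovanov differential. -/
def dCoeff (α β : Σ s : D.State, s.Circ → Bool) : ZMod 2 :=
  D.chainBasis.repr (D.d (D.chainBasis α)) β

theorem weight_le_of_dCoeff_ne_zero [PathConnectedSpace S] (ss : D.SourceSink)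
    {α β : Σ s : D.State, s.Circ → Bool} (h : dCoeff α β ≠ 0) :
    gradeWeight (D.hgrade β) ≤ gradeWeight (D.hgrade α) ∧
      (gradeWeight (D.hgrade β) = gradeWeight (D.hgrade α) → D.hgrade β = D.hgrade α) := by
  classical
  obtain ⟨s, a⟩ := α
  rw [dCoeff, d_eq_sum_crossingMap, LinearMap.sum_apply, map_sum, Finsupp.finsetSum_apply] at h
  obtain ⟨x, -, hx⟩ := Finset.exists_ne_zero_of_sum_ne_zero h
  rw [crossingMap_basis] at hx
  split_ifs at hx with hs
  · rw [map_sum, Finsupp.finsetSum_apply] at hx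
    obtain ⟨b, -, hb⟩ := Finset.exists_ne_zero_of_sum_ne_zero hx
    rw [map_smul, Module.Basis.repr_self, Finsupp.smul_apply, Finsupp.single_apply] at hb
    split_ifs at hb with hβ
    · subst hβ
      exact weight_hgrade_le ss hs fun h0 => hb (by rw [h0, zero_smul])
    · exact absurd (smul_zero _) hb
  · simp at hx

open Classical in
theorem dh_basis (α : Σ s : D.State, s.Circ → Bool) :
    D.dh (D.chainBasis α) =
      ∑ β, (if D.hgrade β = D.hgrade α then dCoeff α β else 0) • D.chainBasis β := by
  rw [dh, Module.Basis.constr_basis, ← D.chainBasis.sum_repr (D.d (D.chainBasis α)), map_sum]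
  refine Finset.sum_congr rfl fun β _ => ?_
  rw [map_smul, hproj, Module.Basis.constr_basis, ite_smul, smul_ite, zero_smul, smul_zero]
  rfl

theorem sum_dCoeff_mul_dCoeff (ss : D.SourceSink) (α γ : Σ s : D.State, s.Circ → Bool) :
    ∑ β, dCoeff α β * dCoeff β γ = 0 := by
  have h := LinearMap.congr_fun (d_comp_d ss) (D.chainBasis α)
  rw [LinearMap.comp_apply, LinearMap.zero_apply,
    ← D.chainBasis.sum_repr (D.d (D.chainBasis α)), map_sum] at h
  have h' := congrArg (fun v => D.chainBasis.repr v γ) h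
  simpa only [dCoeff, map_sum, map_smul, Finsupp.finsetSum_apply, Finsupp.smul_apply, map_zero,
    Finsupp.zero_apply, smul_eq_mul] using h'

theorem dh_comp_dh [PathConnectedSpace S] (ss : D.SourceSink) : D.dh ∘ₗ D.dh = 0 := by
  classical
  refine D.chainBasis.ext fun α => ?_
  rw [LinearMap.comp_apply, dh_basis, map_sum, LinearMap.zero_apply]
  simp only [map_smul, dh_basis, Finset.smul_sum, smul_smul]
  rw [Finset.sum_comm]
  refine Finset.sum_eq_zero fun γ _ => ?_
  rw [← Finset.sum_smul]
  refine (congrArg (· • D.chainBasis γ) ?_).trans (zero_smul (ZMod 2) _)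
  by_cases hγ : D.hgrade γ = D.hgrade α
  · refine Eq.trans ?_ (sum_dCoeff_mul_dCoeff ss α γ)
    refine Finset.sum_congr rfl fun β _ => ?_
    by_cases h1 : dCoeff α β = 0
    · simp [h1]
    by_cases h2 : dCoeff β γ = 0
    · simp [h2]
    have k1 := weight_le_of_dCoeff_ne_zero ss h1
    have k2 := weight_le_of_dCoeff_ne_zero ss h2
    rw [hγ] at k2
    -- The weight of `β` lies between those of `γ` and `α`, which are equal.
    have hβ := k1.2 (le_antisymm k1.1 k2.1)
    rw [if_pos hβ, if_pos (hγ.trans hβ.symm)]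
  · refine Finset.sum_eq_zero fun β _ => ?_
    by_cases hβ : D.hgrade β = D.hgrade α
    · rw [if_neg fun h : D.hgrade γ = D.hgrade β => hγ (h.trans hβ), mul_zero]
    · rw [if_neg hβ, zero_mul]

end LinkDiagram

end HomotopicalKhovanov
end

theorem mainTheorem3 {S : Type*} [TopologicalSpace S] [T2Space S] [CompactSpace S]
    [ConnectedSpace S] [ChartedSpace (EuclideanSpace ℝ (Fin 2)) S]
    [IsManifold (𝓡 2) ∞ S] (o : HomotopicalKhovanov.SurfaceOrientation S)
    (D : HomotopicalKhovanov.LinkDiagram o) (ss : D.SourceSink) :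
    D.dh ∘ₗ D.dh = 0 := by
  -- A connected manifold is path-connected, which supplies the paths from a base point to the
  -- crossings.
  have : LocallyPathConnectedSpace S :=
    ChartedSpace.locallyPathConnectedSpace (EuclideanSpace ℝ (Fin 2)) S
  have : PathConnectedSpace S := pathConnectedSpace_iff_connectedSpace.2 inferInstance
  exact HomotopicalKhovanov.LinkDiagram.dh_comp_dh ss
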